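/- Let $d\ge 2$ and let $G$ be a probability measure on $\mathbb R$ such that, for some $b>a>0$ and $\alpha>0$, $G$ is supported on $[a,b]$ and is absolutely continuous with a density $\rho$ satisfying $\rho(x)\ge\alpha$ for almost all $x\in[a,b]$. Let $E(\mathbb Z^d)$ be the set of nearest-neighbour edges of $\mathbb Z^d$, and let $(t_e)_{e\in E(\mathbb Z^d)}$ be i.i.d. random variables with law $G$. For a finite self-avoiding path $p$ in $\mathbb Z^d$ put $T(p)=\sum_{e\in p}t_e$, and for $u,v\in\mathbb Z^d$ put $T(u,v)=\inf_p T(p)$, the infimum being over all such paths from $u$ to $v$; a path attaining the infimum is called a geodesic from $u$ to $v$. Let $\|\cdot\|$ be the $\ell^2$-norm. There exists a constant $C>0$, depending only on $d$ and $G$, such that for every $v\in\mathbb Z^d$ with $\|v\|\ge 2$, almost surely there is a unique geodesic $\gamma(0,v)$ from $0$ to $v$, and for every $\epsilon>0$, $$\big|\big\{e\in E(\mathbb Z^d):\ \mathbb P(e\in\gamma(0,v))\ge\epsilon\big\}\big|\le C\,\epsilon^{-\frac{2d}{d-1}}\,(\log\|v\|)^{\frac{d(d+1)}{d-1}}.$$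 -/

import Mathlib

open MeasureTheory ProbabilityTheory

namespace FPP

/-- The hypercubic lattice on `ℤ^d`: two points are adjacent when their `ℓ¹`-distance is `1`. -/
def lattice (d : ℕ) : SimpleGraph (Fin d → ℤ) where
  Adj x y := ∑ i, |x i - y i| = 1
  symm := ⟨fun x y h => by simpa only [abs_sub_comm] using h⟩
  loopless := ⟨fun x h => by simp at h⟩

/-- The set `E(ℤ^d)` of (undirected) nearest-neighbour edges. -/
abbrev Edge (d : ℕ) : Type := (lattice d).edgeSet

/-- Finite self-avoiding nearest-neighbour paths from `u` to `v`. -/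
abbrev LatticePath {d : ℕ} (u v : Fin d → ℤ) : Type := (lattice d).Path u v

open Classical in
/-- The finite set of edges of a path. -/
noncomputable def pathEdges {d : ℕ} {u v : Fin d → ℤ} (p : LatticePath u v) : Finset (Edge d) :=
  p.1.edges.toFinset.subtype (fun e => e ∈ (lattice d).edgeSet)

/-- The passage time `T(p) = ∑_{e ∈ p} t_e` of a path in the environment `t`. -/
noncomputable def pathTime {d : ℕ} (t : Edge d → ℝ) {u v : Fin d → ℤ} (p : LatticePath u v) : ℝ :=
  ∑ e ∈ pathEdges p, t e

/-- The passage time `T(u,v) = inf_p T(p)` over all paths `p` from `u` to `v`. -/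
noncomputable def passageTime {d : ℕ} (t : Edge d → ℝ) (u v : Fin d → ℤ) : ℝ :=
  ⨅ p : LatticePath u v, pathTime t p

/-- A geodesic is a path that attains the infimum in the definition of `T(u,v)`. -/
def IsGeodesic {d : ℕ} (t : Edge d → ℝ) {u v : Fin d → ℤ} (p : LatticePath u v) : Prop :=
  pathTime t p = passageTime t u v

/-- The edges lying on a geodesic from `u` to `v`. Whenever the geodesic `γ(u,v)` exists and is
unique, this is exactly its set of edges. -/
def geodesicEdges {d : ℕ} (t : Edge d → ℝ) (u v : Fin d → ℤ) : Set (Edge d) :=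
  {e | ∃ p : LatticePath u v, IsGeodesic t p ∧ e ∈ pathEdges p}

/-- The Euclidean norm of a lattice point. -/
noncomputable def latticeNorm {d : ℕ} (v : Fin d → ℤ) : ℝ :=
  Real.sqrt (∑ i, (v i : ℝ) ^ 2)

/-- `G` is supported on an interval `[a,b]` with `0 < a < b`, and is absolutely continuous with a
density `ρ` satisfying `ρ ≥ α` almost everywhere on `[a,b]`, for some `α > 0`. -/
def HasUniformlyPositiveDensity (G : Measure ℝ) : Prop :=
  ∃ a b α : ℝ, 0 < a ∧ a < b ∧ 0 < α ∧ G (Set.Icc a b)ᶜ = 0 ∧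
    ∃ ρ : ℝ → ENNReal, Measurable ρ ∧ G = volume.withDensity ρ ∧
      ∀ᵐ x : ℝ, x ∈ Set.Icc a b → ENNReal.ofReal α ≤ ρ x

end FPP

/-!
Write `γ` for the geodesic from `0` to `v` and let `A` be a set of edges, each of which lies on `γ`
with probability at least `ε`. The proof compares two effects of raising the weights near `A` a
little.

*The perturbation.* For a set `B` of `M` edges, replace the weight of each edge of `B`,
independently with probability `s = 1 / (2 √M)`, by its maximum with an independent copy
(`coupling`, `jointMeasure`). The law of the new weight has density `1 + s φ` with respect to `G`,
where `|φ| ≤ 1` and `∫ φ dG = 0`. Hence the law of the whole environment changes by a bounded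
amount: by Hölder's inequality, `P(F) ^ 3 ≤ C P'(F) ^ 2` for every event `F`
(`envMeasure_pow_three_le`). On the other hand, given the raised environment, every edge of `B`
whose weight is not close to the bottom of the support has been raised by an amount of order `s` on
average (`le_lintegral_increment`).

*The comparison.* The passage time from `0` to `v` increases at least by the increments along the
geodesic of the raised environment. For a translation vector `x`, the passage time from `x` to
`v + x` increases at most by the increments along the geodesic of the original environment, whose law is
translation invariant. As a geodesic spends time `O(r)` in a cube of radius `r`
(`card_geodesic_inter_boxEdges_le`), the average over `|x| ≤ r` of the expected number of edges of
`B` on these geodesics is `O(M r ^ (1 - d))`. The two passage times never differ by more than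
`O(r)`. Restricting to the event that `γ` has at least `y` heavy edges (those not close to the
bottom of the support) in `B` gives `mul_prob_heavyCount_le`. If `m` is the expected number of
heavy edges of `B` on `γ`, the best choice of `y` and `r` yields `m ^ (2 d) ≤ C M ^ (d + 1)`
(`integral_heavyCount_pow_le`). The level `y` may be much larger than `m`; choosing it with
`exists_level` rather than working with expectations is what avoids a further logarithm.

*From likely edges to heavy edges.* Edges close to the bottom of the support do not percolate, so,
outside an event of probability at most `ε / 2`, at least half of the edges on every stretch
of `γ` of length `K ≈ log ‖v‖` near a given edge are heavy (`envMeasure_real_obstructed_le`). With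
`B = thicken K A` this gives `m ≥ c ε |A|` (`le_integral_heavyCount`), while `M = O(K ^ d |A|)`.
Together, `|A| ^ (d - 1) ε ^ (2 d) ≤ C (log ‖v‖) ^ (d (d + 1))` (`exists_card_pow_mul_pow_le`),
which is the claim. When `ε` is below `‖v‖ ^ (-d)`, the trivial bound `|A| = O(‖v‖ ^ d)` suffices.
-/

namespace FPP

open scoped ENNReal

variable {d : ℕ}

/-! ### Geometry of the lattice -/

/-- The `ℓ¹`-distance on `ℤ^d`, as a natural number. -/
def l1 (x y : Fin d → ℤ) : ℕ := ∑ i, (x i - y i).natAbs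

lemma adj_iff {x y : Fin d → ℤ} : (lattice d).Adj x y ↔ l1 x y = 1 := by
  change ∑ i, |x i - y i| = 1 ↔ _
  rw [l1, ← Nat.cast_inj (R := ℤ)]
  push_cast
  rfl

lemma l1_self (x : Fin d → ℤ) : l1 x x = 0 := by simp [l1]

lemma l1_comm (x y : Fin d → ℤ) : l1 x y = l1 y x :=
  Finset.sum_congr rfl fun i _ => by omega

lemma l1_triangle (x y z : Fin d → ℤ) : l1 x z ≤ l1 x y + l1 y z := by
  rw [l1, l1, l1, ← Finset.sum_add_distrib]
  exact Finset.sum_le_sum fun i _ => by omega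

lemma eq_of_l1_eq_zero {x y : Fin d → ℤ} (h : l1 x y = 0) : x = y := by
  ext i
  have := (Finset.sum_eq_zero_iff.1 h) i (Finset.mem_univ i)
  omega

lemma natAbs_le_l1 (x y : Fin d → ℤ) (i : Fin d) : (x i - y i).natAbs ≤ l1 x y :=
  Finset.single_le_sum (f := fun i => (x i - y i).natAbs) (fun _ _ => Nat.zero_le _)
    (Finset.mem_univ i)

lemma l1_add_right (x y z : Fin d → ℤ) : l1 (x + z) (y + z) = l1 x y := by simp [l1]

/-- The displacement by one unit in the direction `s.1`, with sign given by `s.2`. -/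
def stepVec (s : Fin d × Bool) : Fin d → ℤ := Pi.single s.1 (if s.2 then 1 else -1)

lemma l1_step (x : Fin d → ℤ) (s : Fin d × Bool) : l1 x (x + stepVec s) = 1 := by
  obtain ⟨i, s⟩ := s
  rw [l1, Finset.sum_eq_single i]
  · cases s <;> simp [stepVec]
  · intro j _ hj
    simp [stepVec, Pi.single_eq_of_ne hj]
  · simp

lemma exists_step {x y : Fin d → ℤ} (h : l1 x y = 1) : ∃ s, y = x + stepVec s := by
  obtain ⟨i, hi⟩ : ∃ i, (x i - y i).natAbs ≠ 0 := by
    by_contra! hc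
    simp [l1, hc] at h
  have hle := natAbs_le_l1 x y i
  have hrest : ∀ j, j ≠ i → x j = y j := by
    intro j hj
    have h2 : (x i - y i).natAbs + (x j - y j).natAbs ≤ l1 x y := by
      rw [← Finset.sum_pair (f := fun i => (x i - y i).natAbs) hj.symm]
      exact Finset.sum_le_sum_of_subset (Finset.subset_univ _)
    omega
  refine ⟨(i, decide (y i = x i + 1)), ?_⟩
  ext j
  by_cases hj : j = i
  · subst hj
    by_cases hy : y j = x j + 1
    · simp [stepVec, hy]
    · simp [stepVec, hy]; omega
  · simp [stepVec, Pi.single_eq_of_ne hj, hrest j hj]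

/-- A vertex `x ≠ y` has a neighbour that is one step closer to `y`. -/
lemma exists_adj_l1_succ {x y : Fin d → ℤ} {n : ℕ} (h : l1 x y = n + 1) :
    ∃ z, (lattice d).Adj x z ∧ l1 z y = n := by
  obtain ⟨i, hi⟩ : ∃ i, (x i - y i).natAbs ≠ 0 := by
    by_contra! hc
    simp [l1, hc] at h
  let s : Bool := decide (x i < y i)
  refine ⟨x + stepVec (i, s), adj_iff.2 (l1_step _ _), ?_⟩
  rw [l1, ← Finset.add_sum_erase _ _ (Finset.mem_univ i)] at h ⊢
  have h1 : ∑ j ∈ Finset.univ.erase i, ((x + stepVec (i, s)) j - y j).natAbs =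
      ∑ j ∈ Finset.univ.erase i, (x j - y j).natAbs :=
    Finset.sum_congr rfl fun j hj => by
      simp [stepVec, Pi.single_eq_of_ne (Finset.ne_of_mem_erase hj)]
  rw [h1]
  have h2 : (x + stepVec (i, s)) i = x i + if x i < y i then 1 else -1 := by
    simp [stepVec, s]
  rw [h2]
  split_ifs <;> omega

lemma exists_walk_length_eq_l1 (u v : Fin d → ℤ) :
    ∃ p : (lattice d).Walk u v, p.length = l1 u v := by
  induction hn : l1 u v generalizing u with
  | zero => obtain rfl := eq_of_l1_eq_zero hn; exact ⟨.nil, rfl⟩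
  | succ n ih =>
    obtain ⟨z, hz, hzv⟩ := exists_adj_l1_succ hn
    obtain ⟨p, hp⟩ := ih z hzv
    exact ⟨.cons hz p, by simp [hp]⟩

lemma l1_le_length {u v : Fin d → ℤ} (p : (lattice d).Walk u v) : l1 u v ≤ p.length := by
  induction p with
  | nil => simp [l1_self]
  | @cons u w v h p ih =>
    have := l1_triangle u w v
    have := adj_iff.1 h
    simp only [SimpleGraph.Walk.length_cons]
    omega

lemma l1_le_length_of_mem {u v x y : Fin d → ℤ} (p : (lattice d).Walk u v)
    (hx : x ∈ p.support) (hy : y ∈ p.support) : l1 x y ≤ p.length := by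
  induction p generalizing x y with
  | nil => simp_all [l1_self]
  | @cons u w v h p ih =>
    have key : ∀ z ∈ p.support, l1 u z ≤ p.length + 1 := by
      intro z hz
      have := ih (SimpleGraph.Walk.start_mem_support p) hz
      have := l1_triangle u w z
      have := adj_iff.1 h
      omega
    simp only [SimpleGraph.Walk.support_cons, List.mem_cons, SimpleGraph.Walk.length_cons]
      at hx hy ⊢
    rcases hx with rfl | hx <;> rcases hy with rfl | hy
    · simp [l1_self]
    · exact key y hy
    · rw [l1_comm]; exact key x hx
    · exact (ih hx hy).trans (Nat.le_succ _)

/-- The cube of side `2 r + 1` centred at `u`. -/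
noncomputable def box (u : Fin d → ℤ) (r : ℕ) : Finset (Fin d → ℤ) :=
  Finset.Icc (fun i => u i - r) (fun i => u i + r)

lemma mem_box {u x : Fin d → ℤ} {r : ℕ} : x ∈ box u r ↔ ∀ i, (x i - u i).natAbs ≤ r := by
  simp only [box, Finset.mem_Icc, Pi.le_def, ← forall_and]
  exact forall_congr' fun i => by omega

lemma mem_box_of_l1_le {u x : Fin d → ℤ} {r : ℕ} (h : l1 x u ≤ r) : x ∈ box u r :=
  mem_box.2 fun i => (natAbs_le_l1 x u i).trans h

lemma card_box (u : Fin d → ℤ) (r : ℕ) : (box u r).card = (2 * r + 1) ^ d := by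
  have h : ∀ i, (Finset.Icc (u i - r) (u i + (r : ℤ))).card = 2 * r + 1 := fun i => by
    rw [Int.card_Icc]; omega
  rw [box, Pi.card_Icc, Finset.prod_congr rfl fun i _ => h i]
  simp

lemma l1_le_of_mem_box {u x y : Fin d → ℤ} {r : ℕ} (hx : x ∈ box u r) (hy : y ∈ box u r) :
    l1 x y ≤ 2 * r * d := by
  rw [mem_box] at hx hy
  calc l1 x y ≤ ∑ _i : Fin d, 2 * r :=
        Finset.sum_le_sum fun i _ => by have := hx i; have := hy i; omega
    _ = 2 * r * d := by simp [mul_comm]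

lemma mem_box_comm {x y : Fin d → ℤ} {r : ℕ} : x ∈ box y r ↔ y ∈ box x r := by
  simp only [mem_box]
  exact forall_congr' fun i => by omega

lemma mem_box_trans {x y z : Fin d → ℤ} {r s : ℕ} (h : x ∈ box y r) (h' : y ∈ box z s) :
    x ∈ box z (r + s) := by
  rw [mem_box] at *
  intro i
  have := h i
  have := h' i
  omega

/-- The edge leading from `x` in the direction `s`. -/
def stepEdge (x : Fin d → ℤ) (s : Fin d × Bool) : Edge d :=
  ⟨s(x, x + stepVec s), adj_iff.2 (l1_step x s)⟩

lemma exists_stepEdge (e : Edge d) {x : Fin d → ℤ} (hx : x ∈ e.1) : ∃ s, e = stepEdge x s := by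
  obtain ⟨e, he⟩ := e
  obtain ⟨y, rfl⟩ := Sym2.mem_iff_exists.1 hx
  obtain ⟨s, hs⟩ := exists_step (adj_iff.1 he)
  exact ⟨s, Subtype.ext (congrArg (fun z => s(x, z)) hs)⟩

open Classical in
/-- The edges with at least one endpoint in the cube `box u r`. -/
noncomputable def boxEdges (u : Fin d → ℤ) (r : ℕ) : Finset (Edge d) :=
  (box u r ×ˢ Finset.univ).image fun q => stepEdge q.1 q.2

lemma mem_boxEdges {u : Fin d → ℤ} {r : ℕ} {e : Edge d} :
    e ∈ boxEdges u r ↔ ∃ x ∈ e.1, x ∈ box u r := by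
  classical
  simp only [boxEdges, Finset.mem_image, Finset.mem_product, Finset.mem_univ, and_true, Prod.exists]
  constructor
  · rintro ⟨x, s, i, hx, rfl⟩
    exact ⟨x, Sym2.mem_mk_left _ _, hx⟩
  · rintro ⟨x, hxe, hx⟩
    obtain ⟨s, rfl⟩ := exists_stepEdge e hxe
    exact ⟨x, s.1, s.2, hx, rfl⟩

lemma card_boxEdges_le (u : Fin d → ℤ) (r : ℕ) :
    (boxEdges u r).card ≤ (2 * r + 1) ^ d * (2 * d) := by
  refine Finset.card_image_le.trans ?_
  rw [Finset.card_product, card_box, Finset.card_univ, Fintype.card_prod, Fintype.card_fin,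
    Fintype.card_bool, mul_comm d 2]

lemma mem_box_of_mem_edge {u x : Fin d → ℤ} {r : ℕ} {e : Edge d} (he : e ∈ boxEdges u r)
    (hx : x ∈ e.1) : x ∈ box u (r + 1) := by
  obtain ⟨y, hy, hyu⟩ := mem_boxEdges.1 he
  obtain ⟨s, rfl⟩ := exists_stepEdge e hy
  have hxy : x ∈ box y 1 := by
    refine mem_box_of_l1_le ?_
    rcases Sym2.mem_iff.1 hx with rfl | rfl
    · simp [l1_self]
    · rw [l1_comm, l1_step]
  rw [add_comm]
  exact mem_box_trans hxy hyu

/-- A chosen endpoint of an edge. -/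
noncomputable def base (e : Edge d) : Fin d → ℤ := e.1.out.1

lemma base_mem (e : Edge d) : base e ∈ e.1 := Sym2.out_fst_mem e.1

/-! ### Walks and their edge sets -/

open Classical in
/-- The finite set of edges of a walk. -/
noncomputable def walkEdges {u v : Fin d → ℤ} (p : (lattice d).Walk u v) : Finset (Edge d) :=
  p.edges.toFinset.subtype (fun e => e ∈ (lattice d).edgeSet)

lemma pathEdges_eq {u v : Fin d → ℤ} (p : LatticePath u v) : pathEdges p = walkEdges p.1 := rfl

lemma mem_walkEdges {u v : Fin d → ℤ} {p : (lattice d).Walk u v} {e : Edge d} :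
    e ∈ walkEdges p ↔ e.1 ∈ p.edges := by
  classical simp [walkEdges]

open Classical in
lemma walkEdges_append {u v w : Fin d → ℤ} (p : (lattice d).Walk u v) (q : (lattice d).Walk v w) :
    walkEdges (p.append q) = walkEdges p ∪ walkEdges q := by
  ext e
  simp [mem_walkEdges, SimpleGraph.Walk.edges_append]

lemma card_walkEdges_le {u v : Fin d → ℤ} (p : (lattice d).Walk u v) :
    (walkEdges p).card ≤ p.length := by
  classical
  rw [walkEdges, Finset.card_subtype, ← p.length_edges]
  exact (Finset.card_filter_le _ _).trans (List.toFinset_card_le _)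

lemma card_walkEdges {u v : Fin d → ℤ} {p : (lattice d).Walk u v} (hp : p.IsPath) :
    (walkEdges p).card = p.length := by
  classical
  rw [walkEdges, Finset.card_subtype, Finset.filter_true_of_mem, ← p.length_edges]
  · exact List.toFinset_card_of_nodup hp.isTrail.edges_nodup
  · intro e he
    exact p.edges_subset_edgeSet (List.mem_toFinset.1 he)

lemma mem_support_of_mem_walkEdges {u v x : Fin d → ℤ} {p : (lattice d).Walk u v} {e : Edge d}
    (he : e ∈ walkEdges p) (hx : x ∈ e.1) : x ∈ p.support := by
  obtain ⟨y, hy⟩ := Sym2.mem_iff_exists.1 hx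
  rw [mem_walkEdges, hy] at he
  exact p.fst_mem_support_of_mem_edges he

lemma walkEdges_cons {u v w : Fin d → ℤ} (h : (lattice d).Adj u v) (p : (lattice d).Walk v w)
    (e : Edge d) : e ∈ walkEdges (.cons h p) ↔ e = ⟨s(u, v), h⟩ ∨ e ∈ walkEdges p := by
  rw [mem_walkEdges, mem_walkEdges, SimpleGraph.Walk.edges_cons, List.mem_cons]
  exact or_congr_left ⟨fun h => Subtype.ext h, fun h => by rw [h]⟩

/-- Two self-avoiding paths with the same endpoints and the same edges coincide. -/
lemma eq_of_walkEdges_eq {u v : Fin d → ℤ} {p q : (lattice d).Walk u v} (hp : p.IsPath)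
    (hq : q.IsPath) (h : walkEdges p = walkEdges q) : p = q := by
  induction p with
  | nil => exact (SimpleGraph.Walk.eq_nil_iff_nil.2 (SimpleGraph.Walk.isPath_iff_nil.1 hq)).symm
  | @cons u w v hu p ih =>
    cases q with
    | nil => exact absurd (SimpleGraph.Walk.isPath_iff_nil.1 hp) (by simp)
    | @cons _ w' _ hu' q =>
      rw [SimpleGraph.Walk.cons_isPath_iff] at hp hq
      have key : ∀ {w v : Fin d → ℤ} {hu : (lattice d).Adj u w} {p : (lattice d).Walk w v},
          u ∉ p.support → ∀ x hx, (⟨s(u, x), hx⟩ : Edge d) ∉ walkEdges p := fun hup x hx hmem =>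
        hup (mem_support_of_mem_walkEdges hmem (Sym2.mem_mk_left _ _))
      have hw : w = w' := by
        have h1 := (walkEdges_cons hu' q _).1 (h ▸ (walkEdges_cons hu p ⟨s(u, w), hu⟩).2 (.inl rfl))
        rcases h1 with h1 | h1
        · exact Sym2.congr_right.1 (congrArg Subtype.val h1)
        · exact absurd h1 (key (hu := hu') hq.2 _ _)
      subst hw
      congr 1
      refine ih hp.1 hq.1 (Finset.ext fun e => ?_)
      have h1 := Finset.ext_iff.1 h e
      rw [walkEdges_cons, walkEdges_cons] at h1
      by_cases he : e = ⟨s(u, w), hu⟩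
      · subst he
        exact iff_of_false (key (hu := hu) hp.2 _ _) (key (hu := hu') hq.2 _ _)
      · simpa [he] using h1

/-- A walk that meets a vertex set `B` can be cut at its first visit to `B`: the part before has
no edge inside `B`. -/
lemma exists_append_first {u v : Fin d → ℤ} (p : (lattice d).Walk u v) (B : Set (Fin d → ℤ))
    (h : ∃ x ∈ p.support, x ∈ B) :
    ∃ z ∈ B, ∃ (p₁ : (lattice d).Walk u z) (p₂ : (lattice d).Walk z v), p = p₁.append p₂ ∧
      ∀ e ∈ walkEdges p₁, ∃ x ∈ e.1, x ∉ B := by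
  induction p with
  | @nil u =>
    obtain ⟨x, hx, hxB⟩ := h
    obtain rfl : x = u := by simpa using hx
    exact ⟨x, hxB, .nil, .nil, rfl, by simp [mem_walkEdges]⟩
  | @cons u w v hu p ih =>
    by_cases huB : u ∈ B
    · exact ⟨u, huB, .nil, .cons hu p, rfl, by simp [mem_walkEdges]⟩
    · obtain ⟨x, hx, hxB⟩ := h
      have hx' : x ∈ p.support := by
        rcases List.mem_cons.1 (by simpa using hx) with rfl | h'
        · exact absurd hxB huB
        · exact h'
      obtain ⟨z, hz, p₁, p₂, rfl, hp₁⟩ := ih ⟨x, hx', hxB⟩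
      refine ⟨z, hz, .cons hu p₁, p₂, rfl, fun e he => ?_⟩
      rcases (walkEdges_cons hu p₁ e).1 he with rfl | he
      · exact ⟨u, Sym2.mem_mk_left _ _, huB⟩
      · exact hp₁ e he

lemma walkEdges_reverse {u v : Fin d → ℤ} (p : (lattice d).Walk u v) :
    walkEdges p.reverse = walkEdges p := by
  ext e
  simp [mem_walkEdges]

/-- A walk that meets `B` splits into three parts, the middle one joining two vertices of `B` and
containing all edges inside `B`. -/
lemma exists_append_middle {u v : Fin d → ℤ} (p : (lattice d).Walk u v) (B : Set (Fin d → ℤ))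
    (h : ∃ x ∈ p.support, x ∈ B) :
    ∃ z ∈ B, ∃ z' ∈ B, ∃ (p₁ : (lattice d).Walk u z) (p₂ : (lattice d).Walk z z')
      (p₃ : (lattice d).Walk z' v), p = p₁.append (p₂.append p₃) ∧
      ∀ e ∈ walkEdges p, (∀ x ∈ e.1, x ∈ B) → e ∈ walkEdges p₂ := by
  classical
  obtain ⟨z, hz, p₁, q, rfl, hp₁⟩ := exists_append_first p B h
  obtain ⟨z', hz', q₁, q₂, hq, hq₁⟩ := exists_append_first q.reverse B ⟨z, by simp, hz⟩
  have hq' : q = q₂.reverse.append q₁.reverse := by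
    rw [← SimpleGraph.Walk.reverse_append, ← hq, SimpleGraph.Walk.reverse_reverse]
  refine ⟨z, hz, z', hz', p₁, q₂.reverse, q₁.reverse, by rw [← hq'], fun e he heB => ?_⟩
  rw [hq', walkEdges_append, walkEdges_append, Finset.mem_union, Finset.mem_union,
    walkEdges_reverse q₁] at he
  rcases he with he | he | he
  · obtain ⟨x, hx, hxB⟩ := hp₁ e he
    exact absurd (heB x hx) hxB
  · exact he
  · obtain ⟨x, hx, hxB⟩ := hq₁ e he
    exact absurd (heB x hx) hxB

/-- Every edge of a walk with at least `n ≥ 1` steps lies on a stretch of exactly `n` steps. -/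
lemma exists_window {u v : Fin d → ℤ} (p : (lattice d).Walk u v) {n : ℕ} (hn : 1 ≤ n)
    (hnp : n ≤ p.length) {e : Edge d} (he : e ∈ walkEdges p) :
    ∃ (z z' : Fin d → ℤ) (p₁ : (lattice d).Walk u z) (p₂ : (lattice d).Walk z z')
      (p₃ : (lattice d).Walk z' v), p = p₁.append (p₂.append p₃) ∧ p₂.length = n ∧
      e ∈ walkEdges p₂ := by
  induction p with
  | nil => simp at hnp; omega
  | @cons u w v hu p ih =>
    by_cases hep : e ∈ walkEdges p ∧ n ≤ p.length
    · obtain ⟨z, z', p₁, p₂, p₃, rfl, h1, h2⟩ := ih hep.2 hep.1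
      exact ⟨z, z', .cons hu p₁, p₂, p₃, rfl, h1, h2⟩
    · refine ⟨u, _, .nil, (SimpleGraph.Walk.cons hu p).take n, (SimpleGraph.Walk.cons hu p).drop n,
        by simp, by simp; simpa using hnp, ?_⟩
      rw [mem_walkEdges, SimpleGraph.Walk.edges_take, SimpleGraph.Walk.edges_cons]
      rcases (walkEdges_cons hu p e).1 he with rfl | he'
      · obtain ⟨n, rfl⟩ := Nat.exists_eq_add_of_le' hn
        simp
      · have : p.length < n := by by_contra! hc; exact hep ⟨he', hc⟩
        rw [List.take_of_length_le (by simp; omega)]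
        exact List.mem_cons_of_mem _ (mem_walkEdges.1 he')

/-! ### Passage times in a bounded environment -/

section PassageTime

/-- All edge weights of the environment `t` lie in `[a, b]`. -/
def InRange (a b : ℝ) (t : Edge d → ℝ) : Prop := ∀ e, t e ∈ Set.Icc a b

variable {a b : ℝ} {t : Edge d → ℝ}

lemma InRange.nonneg (ht : InRange a b t) (ha : 0 < a) (e : Edge d) : 0 ≤ t e :=
  ha.le.trans (ht e).1

lemma bddBelow_pathTime (h0 : ∀ e, 0 ≤ t e) (u v : Fin d → ℤ) :
    BddBelow (Set.range fun p : LatticePath u v => pathTime t p) :=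
  ⟨0, by rintro _ ⟨p, rfl⟩; exact Finset.sum_nonneg fun e _ => h0 e⟩

/-- The passage time is bounded by the total weight of any finite edge set that contains the edges
of a walk, self-avoiding or not. -/
lemma passageTime_le_sum (h0 : ∀ e, 0 ≤ t e) {u v : Fin d → ℤ} (p : (lattice d).Walk u v)
    {S : Finset (Edge d)} (hS : walkEdges p ⊆ S) : passageTime t u v ≤ ∑ e ∈ S, t e := by
  classical
  refine (ciInf_le (bddBelow_pathTime h0 u v) ⟨p.bypass, p.bypass_isPath⟩).trans ?_
  refine Finset.sum_le_sum_of_subset_of_nonneg (fun e he => hS ?_) fun e _ _ => h0 e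
  rw [pathEdges_eq, mem_walkEdges] at he
  exact mem_walkEdges.2 (p.edges_bypass_subset_edges he)

lemma InRange.sum_le (ht : InRange a b t) (S : Finset (Edge d)) : ∑ e ∈ S, t e ≤ b * S.card := by
  rw [mul_comm, ← nsmul_eq_mul]
  exact Finset.sum_le_card_nsmul _ _ _ fun e _ => (ht e).2

lemma InRange.le_sum (ht : InRange a b t) (S : Finset (Edge d)) : a * S.card ≤ ∑ e ∈ S, t e := by
  rw [mul_comm, ← nsmul_eq_mul]
  exact Finset.card_nsmul_le_sum _ _ _ fun e _ => (ht e).1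

lemma passageTime_le_l1 (ha : 0 < a) (hb : 0 < b) (ht : InRange a b t) (u v : Fin d → ℤ) :
    passageTime t u v ≤ b * l1 u v := by
  obtain ⟨p, hp⟩ := exists_walk_length_eq_l1 u v
  refine (passageTime_le_sum (ht.nonneg ha) p subset_rfl).trans ((ht.sum_le _).trans ?_)
  have : ((walkEdges p).card : ℝ) ≤ l1 u v := by exact_mod_cast hp ▸ card_walkEdges_le p
  gcongr

lemma pathEdges_subset_boxEdges {u v : Fin d → ℤ} (p : LatticePath u v) {n : ℕ}
    (h : (pathEdges p).card ≤ n) : pathEdges p ⊆ boxEdges u n := by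
  intro e he
  have hx := mem_support_of_mem_walkEdges he (base_mem e)
  refine mem_boxEdges.2 ⟨base e, base_mem e, mem_box_of_l1_le ?_⟩
  rw [pathEdges_eq, card_walkEdges p.2] at h
  exact (l1_le_length_of_mem p.1 hx (SimpleGraph.Walk.start_mem_support _)).trans h

lemma exists_geodesic (ha : 0 < a) (ht : InRange a b t) (u v : Fin d → ℤ) :
    ∃ p : LatticePath u v, IsGeodesic t p := by
  classical
  obtain ⟨w, -⟩ := exists_walk_length_eq_l1 u v
  let p₀ : LatticePath u v := ⟨w.bypass, w.bypass_isPath⟩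
  obtain ⟨n, hn⟩ := exists_nat_ge (pathTime t p₀ / a)
  rw [div_le_iff₀ ha] at hn
  have hmem : ∀ p : LatticePath u v, pathTime t p ≤ pathTime t p₀ →
      pathEdges p ∈ (boxEdges u n).powerset.filter (fun S => ∃ p : LatticePath u v,
        pathEdges p = S) := by
    intro p hp
    refine Finset.mem_filter.2 ⟨Finset.mem_powerset.2 (pathEdges_subset_boxEdges p ?_), p, rfl⟩
    have h1 := ((ht.le_sum (pathEdges p)).trans hp).trans hn
    rw [mul_comm] at h1
    exact_mod_cast le_of_mul_le_mul_right h1 ha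
  obtain ⟨S, hS, hmin⟩ := Finset.exists_min_image _ (fun S => ∑ e ∈ S, t e) ⟨_, hmem p₀ le_rfl⟩
  obtain ⟨p, rfl⟩ := (Finset.mem_filter.1 hS).2
  have hne : Nonempty (LatticePath u v) := ⟨p⟩
  refine ⟨p, le_antisymm (le_ciInf fun q => ?_) (ciInf_le (bddBelow_pathTime (ht.nonneg ha) u v) p)⟩
  rcases le_total (pathTime t q) (pathTime t p₀) with hq | hq
  · exact hmin _ (hmem q hq)
  · exact (hmin _ (hmem p₀ le_rfl)).trans hq

lemma passageTime_triangle (ha : 0 < a) (ht : InRange a b t) (u v w : Fin d → ℤ) :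
    passageTime t u w ≤ passageTime t u v + passageTime t v w := by
  classical
  obtain ⟨p, hp⟩ := exists_geodesic ha ht u v
  obtain ⟨q, hq⟩ := exists_geodesic ha ht v w
  refine (passageTime_le_sum (ht.nonneg ha) (p.1.append q.1) subset_rfl).trans ?_
  rw [← hp, ← hq, walkEdges_append, pathTime, pathTime, pathEdges_eq, pathEdges_eq,
    ← Finset.sum_union_inter]
  exact le_add_of_nonneg_right (Finset.sum_nonneg fun e _ => ht.nonneg ha e)

lemma passageTime_translate_le (ha : 0 < a) (hb : 0 < b) (ht : InRange a b t)
    (u v u' v' : Fin d → ℤ) :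
    passageTime t u v ≤ passageTime t u' v' + b * (l1 u u' + l1 v' v) := by
  have h1 := passageTime_triangle ha ht u u' v
  have h2 := passageTime_triangle ha ht u' v' v
  have h3 := passageTime_le_l1 ha hb ht u u'
  have h4 := passageTime_le_l1 ha hb ht v' v
  linarith

lemma card_geodesic_le (ha : 0 < a) (hb : 0 < b) (ht : InRange a b t) {u v : Fin d → ℤ}
    {p : LatticePath u v} (hp : IsGeodesic t p) : a * (pathEdges p).card ≤ b * l1 u v :=
  (ht.le_sum _).trans (hp.trans_le (passageTime_le_l1 ha hb ht u v))

open Classical in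
/-- A geodesic spends an amount of time at most linear in `r` in a cube of radius `r`: the part
between its first and its last visit could be replaced by a straight path. -/
lemma card_geodesic_inter_boxEdges_le (ha : 0 < a) (hb : 0 < b) (ht : InRange a b t)
    {u v : Fin d → ℤ} {p : LatticePath u v} (hp : IsGeodesic t p) (w : Fin d → ℤ) (r : ℕ) :
    a * (pathEdges p ∩ boxEdges w r).card ≤ b * (2 * (r + 1) * d) := by
  obtain ⟨p, hpath⟩ := p
  rw [pathEdges_eq]
  rcases (walkEdges p ∩ boxEdges w r).eq_empty_or_nonempty with h0 | ⟨e, he⟩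
  · rw [h0]; simp only [Finset.card_empty, Nat.cast_zero, mul_zero]; positivity
  have hB : ∃ x ∈ p.support, x ∈ (box w (r + 1) : Set (Fin d → ℤ)) := by
    rw [Finset.mem_inter] at he
    exact ⟨base e, mem_support_of_mem_walkEdges he.1 (base_mem e),
      mem_box_of_mem_edge he.2 (base_mem e)⟩
  obtain ⟨z, hz, z', hz', p₁, p₂, p₃, hdec, hmid⟩ := exists_append_middle p _ hB
  obtain ⟨q, hq⟩ := exists_walk_length_eq_l1 z z'
  have hsub : walkEdges p ∩ boxEdges w r ⊆ walkEdges p₂ := fun f hf => by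
    rw [Finset.mem_inter] at hf
    exact hmid f hf.1 fun x hx => mem_box_of_mem_edge hf.2 hx
  have hnd := hpath.isTrail.edges_nodup
  rw [hdec, SimpleGraph.Walk.edges_append, SimpleGraph.Walk.edges_append] at hnd
  have hdisj : Disjoint (walkEdges p₂) (walkEdges p₁ ∪ walkEdges p₃) := by
    rw [Finset.disjoint_left]
    intro f hf hf'
    rw [Finset.mem_union, mem_walkEdges, mem_walkEdges] at hf'
    rw [mem_walkEdges] at hf
    have h1 := List.nodup_append.1 hnd
    rcases hf' with hf' | hf'
    · exact h1.2.2 _ hf' _ (List.mem_append_left _ hf) rfl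
    · exact (List.nodup_append.1 h1.2.1).2.2 _ hf _ hf' rfl
  have hsum : pathTime t ⟨p, hpath⟩ =
      ∑ f ∈ walkEdges p₂, t f + ∑ f ∈ walkEdges p₁ ∪ walkEdges p₃, t f := by
    rw [← Finset.sum_union hdisj, pathTime, pathEdges_eq]
    congr 1
    change walkEdges p = _
    rw [hdec, walkEdges_append, walkEdges_append]
    ext f; simp only [Finset.mem_union]; tauto
  have hle : passageTime t u v ≤
      ∑ f ∈ walkEdges q, t f + ∑ f ∈ walkEdges p₁ ∪ walkEdges p₃, t f := by
    refine (passageTime_le_sum (ht.nonneg ha) (p₁.append (q.append p₃)) subset_rfl).trans ?_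
    rw [← Finset.sum_union_inter]
    refine (Finset.sum_le_sum_of_subset_of_nonneg ?_ fun e _ _ => ht.nonneg ha e).trans
      (le_add_of_nonneg_right (Finset.sum_nonneg fun e _ => ht.nonneg ha e))
    rw [walkEdges_append, walkEdges_append]
    intro f; simp only [Finset.mem_union]; tauto
  rw [← hp, hsum] at hle
  have hl : (l1 z z' : ℝ) ≤ 2 * (r + 1) * d := by
    exact_mod_cast l1_le_of_mem_box hz hz'
  have hc : ((walkEdges p ∩ boxEdges w r).card : ℝ) ≤ (walkEdges p₂).card := by
    exact_mod_cast Finset.card_le_card hsub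
  have hcq : ((walkEdges q).card : ℝ) ≤ l1 z z' := by
    exact_mod_cast hq ▸ card_walkEdges_le q
  calc a * ((walkEdges p ∩ boxEdges w r).card : ℝ) ≤ a * (walkEdges p₂).card := by gcongr
    _ ≤ ∑ f ∈ walkEdges p₂, t f := ht.le_sum _
    _ ≤ ∑ f ∈ walkEdges q, t f := by linarith
    _ ≤ b * (walkEdges q).card := ht.sum_le _
    _ ≤ b * (2 * (r + 1) * d) := by gcongr; linarith

/-- If the environment is raised from `s` to `t`, the passage time from `u` to `v` increases at
least by the increments along the geodesic of `t`, while the passage time from `u'` to `v'`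
increases at most by the increments along the geodesic of `s`. Both passage times differ by at most
the cost of joining the endpoints. -/
lemma sum_increments_le (ha : 0 < a) (hb : 0 < b) {s : Edge d → ℝ} (hs : InRange a b s)
    (ht : InRange a b t) {u v u' v' : Fin d → ℤ} {p : LatticePath u v} (hp : IsGeodesic t p)
    {q : LatticePath u' v'} (hq : IsGeodesic s q) :
    ∑ e ∈ pathEdges p, (t e - s e) ≤
      ∑ e ∈ pathEdges q, (t e - s e) + 2 * b * (l1 u u' + l1 v v') := by
  rw [Finset.sum_sub_distrib, Finset.sum_sub_distrib]
  have h1 : ∑ e ∈ pathEdges p, t e = passageTime t u v := hp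
  have h2 : ∑ e ∈ pathEdges q, s e = passageTime s u' v' := hq
  have h3 : passageTime s u v ≤ ∑ e ∈ pathEdges p, s e :=
    passageTime_le_sum (hs.nonneg ha) p.1 subset_rfl
  have h4 : passageTime t u' v' ≤ ∑ e ∈ pathEdges q, t e :=
    passageTime_le_sum (ht.nonneg ha) q.1 subset_rfl
  have h5 := passageTime_translate_le ha hb ht u v u' v'
  have h6 := passageTime_translate_le ha hb hs u' v' u v
  rw [l1_comm v' v] at h5
  rw [l1_comm u' u] at h6
  linarith

/-- Translation by `x` as a permutation of the edges. -/
def shiftEdge (x : Fin d → ℤ) : Edge d ≃ Edge d where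
  toFun e := ⟨e.1.map (· + x), by
    obtain ⟨e, he⟩ := e
    induction e with | _ y z => exact adj_iff.2 ((l1_add_right y z x).trans (adj_iff.1 he))⟩
  invFun e := ⟨e.1.map (· + -x), by
    obtain ⟨e, he⟩ := e
    induction e with | _ y z => exact adj_iff.2 ((l1_add_right y z (-x)).trans (adj_iff.1 he))⟩
  left_inv e := Subtype.ext (by
    obtain ⟨e, he⟩ := e
    induction e with | _ y z => simp)
  right_inv e := Subtype.ext (by
    obtain ⟨e, he⟩ := e
    induction e with | _ y z => simp)

lemma mem_shiftEdge {x y : Fin d → ℤ} {e : Edge d} : y ∈ (shiftEdge x e).1 ↔ y - x ∈ e.1 := by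
  change y ∈ Sym2.map (· + x) e.1 ↔ _
  rw [Sym2.mem_map]
  constructor
  · rintro ⟨z, hz, rfl⟩; simpa using hz
  · intro h; exact ⟨_, h, by simp⟩

/-- The translate of a lattice path. -/
def shiftPath (x : Fin d → ℤ) {u v : Fin d → ℤ} : LatticePath u v → LatticePath (u + x) (v + x) :=
  fun p => ⟨p.1.map ⟨(· + x), fun {y z} h => adj_iff.2 ((l1_add_right y z x).trans (adj_iff.1 h))⟩,
    p.2.map (add_left_injective x)⟩

lemma pathEdges_shiftPath (x : Fin d → ℤ) {u v : Fin d → ℤ} (p : LatticePath u v) :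
    pathEdges (shiftPath x p) = (pathEdges p).map (shiftEdge x).toEmbedding := by
  ext e
  rw [pathEdges_eq, mem_walkEdges, Finset.mem_map_equiv, pathEdges_eq, mem_walkEdges]
  obtain ⟨f, rfl⟩ := (shiftEdge x).surjective e
  rw [Equiv.symm_apply_apply]
  change (shiftEdge x f).1 ∈ (p.1.map _).edges ↔ _
  rw [SimpleGraph.Walk.edges_map, List.mem_map]
  constructor
  · rintro ⟨g, hg, h⟩
    exact (Sym2.map.injective (add_left_injective x) h) ▸ hg
  · intro h; exact ⟨_, h, rfl⟩

lemma pathTime_shiftPath (x : Fin d → ℤ) {u v : Fin d → ℤ} (p : LatticePath u v) :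
    pathTime t (shiftPath x p) = pathTime (fun e => t (shiftEdge x e)) p := by
  rw [pathTime, pathEdges_shiftPath, Finset.sum_map]; rfl

lemma passageTime_shift_le (h0 : ∀ e, 0 ≤ t e) (x u v : Fin d → ℤ) :
    passageTime t (u + x) (v + x) ≤ passageTime (fun e => t (shiftEdge x e)) u v := by
  classical
  obtain ⟨w, -⟩ := exists_walk_length_eq_l1 u v
  have hne : Nonempty (LatticePath u v) := ⟨⟨w.bypass, w.bypass_isPath⟩⟩
  refine le_ciInf fun p => ?_
  rw [← pathTime_shiftPath]
  exact ciInf_le (bddBelow_pathTime h0 _ _) _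

lemma shiftEdge_neg (x : Fin d → ℤ) (e : Edge d) : shiftEdge x (shiftEdge (-x) e) = e := by
  refine Subtype.ext (Sym2.ext fun y => ?_)
  rw [mem_shiftEdge, mem_shiftEdge]
  simp

lemma passageTime_shift (h0 : ∀ e, 0 ≤ t e) (x u v : Fin d → ℤ) :
    passageTime t (u + x) (v + x) = passageTime (fun e => t (shiftEdge x e)) u v := by
  refine le_antisymm (passageTime_shift_le h0 x u v) ?_
  have h := passageTime_shift_le (t := fun e => t (shiftEdge x e)) (fun e => h0 _) (-x)
    (u + x) (v + x)
  simpa only [add_neg_cancel_right, shiftEdge_neg] using h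

lemma isGeodesic_shiftPath (h0 : ∀ e, 0 ≤ t e) (x : Fin d → ℤ) {u v : Fin d → ℤ}
    {p : LatticePath u v} (hp : IsGeodesic (fun e => t (shiftEdge x e)) p) :
    IsGeodesic t (shiftPath x p) := by
  rw [IsGeodesic, pathTime_shiftPath, passageTime_shift h0]
  exact hp

lemma geodesicEdges_eq {u v : Fin d → ℤ} (h : ∃! p : LatticePath u v, IsGeodesic t p)
    {p : LatticePath u v} (hp : IsGeodesic t p) : geodesicEdges t u v = pathEdges p := by
  ext e
  exact ⟨fun ⟨q, hq, he⟩ => h.unique hp hq ▸ he, fun he => ⟨p, hp, he⟩⟩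

end PassageTime

/-! ### Stretches of a geodesic that avoid cheap edges -/

section Stretches

variable {a b : ℝ} {t : Edge d → ℝ}

open Classical in
/-- A finite family of edge sets that contains the edge set of every walk with `n` steps started
from `u`. -/
noncomputable def edgeFamily : ℕ → (Fin d → ℤ) → Finset (Finset (Edge d))
  | 0, _ => {∅}
  | n + 1, u => Finset.univ.biUnion fun s : Fin d × Bool =>
      (edgeFamily n (u + stepVec s)).image (insert (stepEdge u s))

lemma card_edgeFamily_le (n : ℕ) (u : Fin d → ℤ) : (edgeFamily n u).card ≤ (2 * d) ^ n := by
  classical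
  induction n generalizing u with
  | zero => simp [edgeFamily]
  | succ n ih =>
    rw [edgeFamily, pow_succ']
    have h := Finset.card_biUnion_le_card_mul (Finset.univ : Finset (Fin d × Bool))
      (fun s => (edgeFamily n (u + stepVec s)).image (insert (stepEdge u s))) ((2 * d) ^ n)
      fun s _ => Finset.card_image_le.trans (ih _)
    rwa [Finset.card_univ, Fintype.card_prod, Fintype.card_fin, Fintype.card_bool,
      mul_comm d 2] at h

lemma walkEdges_mem_edgeFamily {u v : Fin d → ℤ} (p : (lattice d).Walk u v) :
    walkEdges p ∈ edgeFamily p.length u := by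
  classical
  induction p with
  | nil =>
    rw [SimpleGraph.Walk.length_nil, edgeFamily, Finset.mem_singleton]
    ext e
    simp [mem_walkEdges]
  | @cons u w v h p ih =>
    obtain ⟨s, hs⟩ := exists_step (adj_iff.1 h)
    rw [SimpleGraph.Walk.length_cons, edgeFamily, Finset.mem_biUnion]
    refine ⟨s, Finset.mem_univ _, Finset.mem_image.2 ⟨walkEdges p, hs ▸ ih, ?_⟩⟩
    ext e
    rw [walkEdges_cons, Finset.mem_insert]
    have : stepEdge u s = ⟨s(u, w), h⟩ := Subtype.ext (congrArg (fun z => s(u, z)) hs.symm)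
    rw [this]

/-- The edge `e` is obstructed at scale `K` if some set of `K` edges that may be traversed by a walk
started near `e` consists for more than one half of edges of weight at most `c`. -/
def Obstructed (c : ℝ) (K : ℕ) (t : Edge d → ℝ) (e : Edge d) : Prop :=
  ∃ u ∈ box (base e) K, ∃ S ∈ edgeFamily K u, S.card = K ∧
    K < 2 * (S.filter fun f => t f ≤ c).card

open Classical in
/-- The edges within distance `K` of a set of edges. -/
noncomputable def thicken (K : ℕ) (A : Finset (Edge d)) : Finset (Edge d) :=
  A.biUnion fun e => boxEdges (base e) K

lemma card_thicken_le (K : ℕ) (A : Finset (Edge d)) :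
    (thicken K A).card ≤ A.card * ((2 * K + 1) ^ d * (2 * d)) :=
  Finset.card_biUnion_le_card_mul _ _ _ fun _ _ => card_boxEdges_le _ _

open Classical in
/-- Near each of its edges that is not obstructed, a long path has at least `K / 2` edges of weight
larger than `c`. -/
lemma le_card_filter_of_not_obstructed {u v : Fin d → ℤ} (p : LatticePath u v) {K : ℕ} (hK : 1 ≤ K)
    (hKp : K ≤ (pathEdges p).card) {c : ℝ} {e : Edge d} (he : e ∈ pathEdges p)
    (hobs : ¬ Obstructed c K t e) :
    K ≤ 2 * ((pathEdges p).filter fun f => c < t f ∧ f ∈ boxEdges (base e) K).card := by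
  obtain ⟨p, hp⟩ := p
  rw [pathEdges_eq] at *
  rw [card_walkEdges hp] at hKp
  obtain ⟨z, z', p₁, p₂, p₃, hdec, hlen, he₂⟩ := exists_window p hK hKp he
  have hpath₂ : p₂.IsPath := by
    rw [hdec] at hp
    exact hp.of_append_right.of_append_left
  have hbase : base e ∈ p₂.support := mem_support_of_mem_walkEdges he₂ (base_mem e)
  have hz : z ∈ box (base e) K := mem_box_of_l1_le
    (hlen ▸ l1_le_length_of_mem p₂ (SimpleGraph.Walk.start_mem_support _) hbase)
  have hcard : (walkEdges p₂).card = K := (card_walkEdges hpath₂).trans hlen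
  have hlow : 2 * ((walkEdges p₂).filter fun f => t f ≤ c).card ≤ K := by
    by_contra! hc
    exact hobs ⟨z, hz, _, hlen ▸ walkEdges_mem_edgeFamily p₂, hcard, hc⟩
  have hsplit := Finset.card_filter_add_card_filter_not (s := walkEdges p₂) (fun f => t f ≤ c)
  have hsub : (walkEdges p₂).filter (fun f => ¬ t f ≤ c) ⊆
      (walkEdges p).filter fun f => c < t f ∧ f ∈ boxEdges (base e) K := by
    intro f hf
    rw [Finset.mem_filter] at hf ⊢
    refine ⟨?_, not_le.1 hf.2, mem_boxEdges.2 ⟨base f, base_mem f, mem_box_of_l1_le ?_⟩⟩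
    · rw [hdec, walkEdges_append, walkEdges_append]
      simp [hf.1]
    · exact hlen ▸ l1_le_length_of_mem p₂ (mem_support_of_mem_walkEdges hf.1 (base_mem f)) hbase
  have := Finset.card_le_card hsub
  change K ≤ 2 * ((walkEdges p).filter fun f => c < t f ∧ f ∈ boxEdges (base e) K).card
  omega

open Classical in
/-- The number of non-obstructed edges of `A` on a geodesic is at most a constant times the number
of its edges of weight larger than `c` within distance `K` of `A`: each of the former is close to
`K / 2` of the latter, and each of the latter is close to at most `C K` edges of the geodesic. -/
lemma card_not_obstructed_le (ha : 0 < a) (hb : 0 < b) (ht : InRange a b t) {u v : Fin d → ℤ}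
    {p : LatticePath u v} (hp : IsGeodesic t p) {K : ℕ} (hK : 1 ≤ K)
    (hKp : K ≤ (pathEdges p).card) {c : ℝ} (A : Finset (Edge d)) :
    a * (A.filter fun e => e ∈ pathEdges p ∧ ¬ Obstructed c K t e).card ≤
      12 * b * d * ((thicken K A).filter fun f => f ∈ pathEdges p ∧ c < t f).card := by
  set A' := A.filter fun e => e ∈ pathEdges p ∧ ¬ Obstructed c K t e with hA'
  set Y := (thicken K A).filter fun f => f ∈ pathEdges p ∧ c < t f with hY
  have hcount := Finset.sum_card_bipartiteAbove_eq_sum_card_bipartiteBelow (s := A') (t := Y)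
    fun e f => f ∈ boxEdges (base e) K
  have hlow : A'.card * K ≤
      2 * ∑ e ∈ A', (Y.bipartiteAbove (fun e f => f ∈ boxEdges (base e) K) e).card := by
    rw [Finset.mul_sum, ← smul_eq_mul]
    refine Finset.card_nsmul_le_sum _ _ _ fun e he => ?_
    rw [hA', Finset.mem_filter] at he
    refine (le_card_filter_of_not_obstructed p hK hKp he.2.1 he.2.2).trans ?_
    gcongr
    intro f hf
    rw [Finset.mem_filter] at hf
    rw [Finset.bipartiteAbove, Finset.mem_filter, hY, Finset.mem_filter]
    exact ⟨⟨Finset.mem_biUnion.2 ⟨e, he.1, hf.2.2⟩, hf.1, hf.2.1⟩, hf.2.2⟩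
  have hup : a * (∑ f ∈ Y, (A'.bipartiteBelow (fun e f => f ∈ boxEdges (base e) K) f).card : ℕ) ≤
      Y.card * (b * (6 * K * d)) := by
    push_cast
    rw [Finset.mul_sum, ← nsmul_eq_mul]
    refine Finset.sum_le_card_nsmul _ _ _ fun f _ => ?_
    have hsub : A'.bipartiteBelow (fun e f => f ∈ boxEdges (base e) K) f ⊆
        pathEdges p ∩ boxEdges (base f) (K + 1) := by
      intro e he
      rw [Finset.bipartiteBelow, Finset.mem_filter, hA', Finset.mem_filter] at he
      exact Finset.mem_inter.2 ⟨he.1.2.1, mem_boxEdges.2 ⟨base e, base_mem e,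
        mem_box_comm.1 (mem_box_of_mem_edge he.2 (base_mem f))⟩⟩
    have h1 := card_geodesic_inter_boxEdges_le ha hb ht hp (base f) (K + 1)
    have h2 : ((A'.bipartiteBelow (fun e f => f ∈ boxEdges (base e) K) f).card : ℝ) ≤
        (pathEdges p ∩ boxEdges (base f) (K + 1)).card := by
      exact_mod_cast Finset.card_le_card hsub
    have hK' : (1 : ℝ) ≤ K := by exact_mod_cast hK
    refine (mul_le_mul_of_nonneg_left h2 ha.le).trans (h1.trans ?_)
    push_cast
    have h3 : 2 * ((K : ℝ) + 1 + 1) * d ≤ 6 * K * d :=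
      mul_le_mul_of_nonneg_right (by linarith) (Nat.cast_nonneg d)
    exact mul_le_mul_of_nonneg_left h3 hb.le
  rw [hcount] at hlow
  have hK0 : (0 : ℝ) < K := by exact_mod_cast hK
  have hlow' : (A'.card : ℝ) * K ≤
      2 * (∑ f ∈ Y, (A'.bipartiteBelow (fun e f => f ∈ boxEdges (base e) K) f).card : ℕ) := by
    exact_mod_cast hlow
  refine le_of_mul_le_mul_right ?_ hK0
  calc a * A'.card * K = a * (A'.card * K) := by ring
    _ ≤ a * (2 * (∑ f ∈ Y, (A'.bipartiteBelow (fun e f => f ∈ boxEdges (base e) K) f).card : ℕ)) :=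
      mul_le_mul_of_nonneg_left hlow' ha.le
    _ ≤ 2 * (Y.card * (b * (6 * K * d))) := by linarith
    _ = 12 * b * d * Y.card * K := by ring

end Stretches

/-! ### Infinite products: resampling and change of measure -/

section Product

variable {ι : Type*} {E : ι → Type*} [∀ i, MeasurableSpace (E i)]

/-- Resampling one coordinate preserves a product measure. -/
lemma map_update_infinitePi [DecidableEq ι] (μ : ∀ i, Measure (E i))
    [∀ i, IsProbabilityMeasure (μ i)] (i : ι) :
    ((Measure.infinitePi μ).prod (μ i)).map (fun q => Function.update q.1 i q.2) =
      Measure.infinitePi μ := by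
  refine Measure.eq_infinitePi _ fun s t ht => ?_
  rw [Measure.map_apply measurable_update' (.pi s.countable_toSet fun _ _ => ht _)]
  have hpre : (fun q : (∀ j, E j) × E i => Function.update q.1 i q.2) ⁻¹' (Set.pi s t) =
      (Set.pi (s.erase i : Finset ι) t) ×ˢ (if i ∈ s then t i else Set.univ) := by
    ext ⟨x, y⟩
    simp only [Set.mem_preimage, Set.mem_pi, Finset.mem_coe, Set.mem_prod, Finset.mem_erase]
    constructor
    · intro h
      refine ⟨fun j hj => by simpa [hj.1] using h j hj.2, ?_⟩
      split_ifs with hi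
      · simpa using h i hi
      · trivial
    · rintro ⟨h1, h2⟩ j hj
      by_cases hji : j = i
      · subst hji; simpa [hj] using h2
      · simpa [hji] using h1 j ⟨hji, hj⟩
  rw [hpre, Measure.prod_prod, Measure.infinitePi_pi _ fun j _ => ht j]
  split_ifs with hi
  · exact Finset.prod_erase_mul s (fun j => μ j (t j)) hi
  · rw [Finset.erase_eq_of_notMem hi, measure_univ, mul_one]

lemma lintegral_infinitePi_update [DecidableEq ι] (μ : ∀ i, Measure (E i))
    [∀ i, IsProbabilityMeasure (μ i)] (i : ι) {f : (∀ j, E j) → ℝ≥0∞} (hf : Measurable f) :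
    ∫⁻ x, f x ∂Measure.infinitePi μ =
      ∫⁻ x, ∫⁻ y, f (Function.update x i y) ∂μ i ∂Measure.infinitePi μ := by
  conv_lhs => rw [← map_update_infinitePi μ i, lintegral_map hf measurable_update']
  exact lintegral_prod _ (hf.comp measurable_update').aemeasurable

lemma lintegral_prod_infinitePi (μ : ∀ i, Measure (E i)) [∀ i, IsProbabilityMeasure (μ i)]
    (s : Finset ι) {f : ∀ i, E i → ℝ≥0∞} (hf : ∀ i, Measurable (f i)) :
    ∫⁻ x, ∏ i ∈ s, f i (x i) ∂Measure.infinitePi μ = ∏ i ∈ s, ∫⁻ y, f i y ∂μ i := by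
  refine (lintegral_prod_eq_prod_lintegral_of_indepFun s (fun i (x : ∀ i, E i) => f i (x i))
    (iIndepFun_infinitePi hf) fun i => by fun_prop).trans (Finset.prod_congr rfl fun i _ => ?_)
  conv_rhs => rw [← Measure.infinitePi_map_eval μ i, lintegral_map (hf i) (by fun_prop)]

/-- If finitely many factors of a product measure are replaced by measures with densities, then the
product measure acquires the product of these densities. -/
lemma withDensity_prod_infinitePi (μ : ∀ i, Measure (E i)) [∀ i, IsProbabilityMeasure (μ i)]
    {g : ∀ i, E i → ℝ≥0∞} (hg : ∀ i, Measurable (g i))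
    (ν : ∀ i, Measure (E i)) [∀ i, IsProbabilityMeasure (ν i)]
    (hν : ∀ i, ν i = (μ i).withDensity (g i)) (s : Finset ι) (hs : ∀ i ∉ s, ν i = μ i) :
    (Measure.infinitePi μ).withDensity (fun x => ∏ i ∈ s, g i (x i)) = Measure.infinitePi ν := by
  classical
  refine Measure.eq_infinitePi _ fun T t ht => ?_
  have hmeas : MeasurableSet (Set.pi (T : Set ι) t) := .pi T.countable_toSet fun _ _ => ht _
  rw [withDensity_apply _ hmeas, ← lintegral_indicator hmeas]
  let f : ∀ i, E i → ℝ≥0∞ := fun i =>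
    if i ∈ T then (t i).indicator (if i ∈ s then g i else 1) else (if i ∈ s then g i else 1)
  have hf0 : ∀ i, Measurable (if i ∈ s then g i else 1 : E i → ℝ≥0∞) := fun i => by
    split_ifs
    · exact hg i
    · exact measurable_const
  have hf : ∀ i, Measurable (f i) := fun i => by
    simp only [f]
    split_ifs with h1 h2 h2
    · exact (hg i).indicator (ht i)
    · exact measurable_const.indicator (ht i)
    · exact hg i
    · exact measurable_const
  have hrew : (Set.pi (T : Set ι) t).indicator (fun x => ∏ i ∈ s, g i (x i)) =
      fun x => ∏ i ∈ T ∪ s, f i (x i) := by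
    ext x
    by_cases hx : x ∈ Set.pi (T : Set ι) t
    · rw [Set.indicator_of_mem hx, ← Finset.prod_subset Finset.subset_union_right (f := fun i =>
        f i (x i))]
      · refine Finset.prod_congr rfl fun i hi => ?_
        simp only [f, hi, if_true]
        split_ifs with h1
        · rw [Set.indicator_of_mem (hx i h1)]
        · rfl
      · intro i hi his
        have hiT : i ∈ T := by simpa [his] using hi
        simp [f, hiT, his, Set.indicator_of_mem (hx i hiT)]
    · rw [Set.indicator_of_notMem hx]
      obtain ⟨i, hi, hxi⟩ : ∃ i ∈ T, x i ∉ t i := by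
        simpa [Set.mem_pi] using hx
      refine (Finset.prod_eq_zero (Finset.mem_union_left _ hi) ?_).symm
      simp [f, hi, Set.indicator_of_notMem hxi]
  have hval : ∀ i, ∫⁻ y, f i y ∂μ i = if i ∈ T then ν i (t i) else 1 := by
    intro i
    have hνi : ν i = (μ i).withDensity (if i ∈ s then g i else 1) := by
      split_ifs with h
      · exact hν i
      · rw [hs i h, withDensity_one]
    by_cases hi : i ∈ T
    · simp only [f, hi, if_true]
      rw [lintegral_indicator (ht i), hνi, withDensity_apply _ (ht i)]
    · simp only [f, hi, if_false]
      rw [← setLIntegral_univ, ← withDensity_apply _ MeasurableSet.univ, ← hνi, measure_univ]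
  rw [hrew, lintegral_prod_infinitePi μ _ hf, Finset.prod_congr rfl fun i _ => hval i,
    Finset.prod_ite_mem, Finset.inter_eq_right.2 Finset.subset_union_left]

/-- A form of Hölder's inequality: an event cannot become much less likely under a change of
measure whose inverse density has a bounded second moment with respect to the original measure. -/
lemma measure_pow_three_le {Ω : Type*} [MeasurableSpace Ω] (μ : Measure Ω) {Z : Ω → ℝ≥0∞}
    (hZ : Measurable Z) (h0 : ∀ x, Z x ≠ 0) (htop : ∀ x, Z x ≠ ∞) {F : Set Ω}
    (hF : MeasurableSet F) :
    μ F ^ 3 ≤ μ.withDensity Z F ^ 2 * ∫⁻ x, (Z x)⁻¹ ^ 2 ∂μ := by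
  have hpq : (3 / 2 : ℝ).HolderConjugate 3 := by
    rw [Real.holderConjugate_iff]; norm_num
  have h := ENNReal.lintegral_mul_le_Lp_mul_Lq μ hpq
    (f := F.indicator fun x => Z x ^ (2 / 3 : ℝ)) (g := fun x => (Z x)⁻¹ ^ (2 / 3 : ℝ))
    ((hZ.pow_const _).indicator hF).aemeasurable (hZ.inv.pow_const _).aemeasurable
  have h1 : ∀ x, ((F.indicator fun x => Z x ^ (2 / 3 : ℝ)) * fun x => (Z x)⁻¹ ^ (2 / 3 : ℝ)) x =
      F.indicator 1 x := by
    intro x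
    by_cases hx : x ∈ F
    · simp only [Pi.mul_apply, Set.indicator_of_mem hx, Pi.one_apply]
      rw [← ENNReal.mul_rpow_of_nonneg _ _ (by norm_num), ENNReal.mul_inv_cancel (h0 x) (htop x),
        ENNReal.one_rpow]
    · simp [Set.indicator_of_notMem hx]
  have h2 : ∀ x, (F.indicator fun x => Z x ^ (2 / 3 : ℝ)) x ^ (3 / 2 : ℝ) = F.indicator Z x := by
    intro x
    by_cases hx : x ∈ F
    · simp only [Set.indicator_of_mem hx]
      rw [← ENNReal.rpow_mul]; norm_num
    · simp [Set.indicator_of_notMem hx]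
  have h3 : ∀ x, ((Z x)⁻¹ ^ (2 / 3 : ℝ)) ^ (3 : ℝ) = (Z x)⁻¹ ^ 2 := by
    intro x
    rw [← ENNReal.rpow_mul, ← ENNReal.rpow_natCast]; norm_num
  simp only [h1, h2, h3] at h
  rw [lintegral_indicator_one hF, lintegral_indicator hF, ← withDensity_apply _ hF] at h
  calc μ F ^ 3 ≤ (μ.withDensity Z F ^ (1 / (3 / 2) : ℝ) *
        (∫⁻ x, (Z x)⁻¹ ^ 2 ∂μ) ^ (1 / 3 : ℝ)) ^ 3 := by gcongr
    _ = μ.withDensity Z F ^ 2 * ∫⁻ x, (Z x)⁻¹ ^ 2 ∂μ := by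
      rw [mul_pow, ← ENNReal.rpow_natCast (_ ^ (1 / (3 / 2) : ℝ)), ← ENNReal.rpow_mul,
        ← ENNReal.rpow_natCast (_ ^ (1 / 3 : ℝ)), ← ENNReal.rpow_mul, ← ENNReal.rpow_natCast]
      norm_num

end Product

/-! ### Raising the weight of one edge -/

section Coupling

variable (G : Measure ℝ) [IsProbabilityMeasure G]

/-- The joint law of a random variable `y` with law `G` and the variable obtained from it by
replacing it, with probability `θ`, by the maximum of `y` and an independent copy of `y`. -/
noncomputable def coupling (θ : ℝ) : Measure (ℝ × ℝ) :=
  ENNReal.ofReal (1 - θ) • G.map (fun y => (y, y)) +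
    ENNReal.ofReal θ • (G.prod G).map (fun q => (q.1, max q.1 q.2))

variable {G} {θ : ℝ}

lemma lintegral_coupling {f : ℝ × ℝ → ℝ≥0∞} (hf : Measurable f) :
    ∫⁻ q, f q ∂coupling G θ = ENNReal.ofReal (1 - θ) * ∫⁻ y, f (y, y) ∂G +
      ENNReal.ofReal θ * ∫⁻ y, ∫⁻ y', f (y, max y y') ∂G ∂G := by
  rw [coupling, lintegral_add_measure, lintegral_smul_measure, lintegral_smul_measure,
    lintegral_map hf (by fun_prop), lintegral_map hf (by fun_prop),
    lintegral_prod _ (by fun_prop)]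
  rfl

lemma ofReal_one_sub_add (h0 : 0 ≤ θ) (h1 : θ ≤ 1) :
    ENNReal.ofReal (1 - θ) + ENNReal.ofReal θ = 1 := by
  rw [← ENNReal.ofReal_add (by linarith) h0]; simp

lemma isProbabilityMeasure_coupling (h0 : 0 ≤ θ) (h1 : θ ≤ 1) :
    IsProbabilityMeasure (coupling G θ) := by
  constructor
  rw [← lintegral_one, lintegral_coupling measurable_const]
  simp [ofReal_one_sub_add h0 h1]

lemma lintegral_coupling_fst (h0 : 0 ≤ θ) (h1 : θ ≤ 1) {f : ℝ → ℝ≥0∞} (hf : Measurable f) :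
    ∫⁻ q, f q.1 ∂coupling G θ = ∫⁻ y, f y ∂G := by
  rw [lintegral_coupling (by fun_prop)]
  simp [← add_mul, ofReal_one_sub_add h0 h1]

lemma map_fst_coupling (h0 : 0 ≤ θ) (h1 : θ ≤ 1) : (coupling G θ).map Prod.fst = G := by
  refine Measure.ext_of_lintegral _ fun f hf => ?_
  rw [lintegral_map hf measurable_fst, lintegral_coupling_fst h0 h1 hf]

/-- The centred distribution function `2 G((-∞, x]) - 1`. -/
noncomputable def centredCDF (G : Measure ℝ) (x : ℝ) : ℝ := 2 * G.real (Set.Iic x) - 1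

lemma measurable_measureReal_Iic : Measurable fun x => G.real (Set.Iic x) :=
  Monotone.measurable fun _ _ h => measureReal_mono (Set.Iic_subset_Iic.2 h)

lemma measurable_centredCDF : Measurable (centredCDF G) :=
  (measurable_measureReal_Iic.const_mul 2).sub_const 1

lemma abs_centredCDF_le (x : ℝ) : |centredCDF G x| ≤ 1 := by
  have h0 : 0 ≤ G.real (Set.Iic x) := measureReal_nonneg
  have h1 : G.real (Set.Iic x) ≤ 1 := measureReal_le_one
  rw [centredCDF, abs_le]; constructor <;> linarith

/-- For atomless `G`, the maximum of two independent variables has density `2 G((-∞, x])`. -/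
lemma lintegral_max [NullSingletonClass G] {f : ℝ → ℝ≥0∞} (hf : Measurable f) :
    ∫⁻ y, ∫⁻ y', f (max y y') ∂G ∂G = ∫⁻ y, 2 * G (Set.Iic y) * f y ∂G := by
  have hsplit : ∀ y y', f (max y y') =
      (Set.Iic y).indicator (fun _ => f y) y' + (Set.Iio y').indicator (fun _ => f y') y := by
    intro y y'
    rcases le_or_gt y' y with h | h
    · simp [h, not_lt.2 h]
    · simp [h, h.le, not_le.2 h]
  have hm2 : MeasurableSet {q : ℝ × ℝ | q.1 < q.2} := measurableSet_lt measurable_fst measurable_snd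
  have hmeas2 : Measurable fun q : ℝ × ℝ => (Set.Iio q.2).indicator (fun _ => f q.2) q.1 :=
    (hf.comp measurable_snd).indicator hm2
  simp_rw [hsplit]
  have h1 : ∀ y, ∫⁻ y', ((Set.Iic y).indicator (fun _ => f y) y' +
      (Set.Iio y').indicator (fun _ => f y') y) ∂G =
      G (Set.Iic y) * f y + ∫⁻ y', (Set.Iio y').indicator (fun _ => f y') y ∂G := by
    intro y
    rw [lintegral_add_left (measurable_const.indicator measurableSet_Iic),
      lintegral_indicator_const measurableSet_Iic, mul_comm]
  have hIic : Measurable fun y => G (Set.Iic y) :=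
    Monotone.measurable fun _ _ h => measure_mono (Set.Iic_subset_Iic.2 h)
  have hm : Measurable fun y => G (Set.Iic y) * f y := hIic.mul hf
  simp_rw [h1]
  rw [lintegral_add_left hm, lintegral_lintegral_swap hmeas2.aemeasurable,
    ← lintegral_add_left hm]
  refine lintegral_congr fun y => ?_
  rw [lintegral_indicator_const measurableSet_Iio, measure_congr Iio_ae_eq_Iic]
  ring

/-- The density of the raised weight with respect to `G`. -/
noncomputable def raisedDensity (G : Measure ℝ) (θ x : ℝ) : ℝ≥0∞ :=
  ENNReal.ofReal (1 + θ * centredCDF G x)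

lemma measurable_raisedDensity : Measurable (raisedDensity G θ) :=
  ENNReal.measurable_ofReal.comp ((measurable_centredCDF.const_mul θ).const_add 1)

lemma raisedDensity_zero (μ : Measure ℝ) : raisedDensity μ 0 = 1 := by
  ext x; simp [raisedDensity]

lemma map_snd_coupling [NullSingletonClass G] (h0 : 0 ≤ θ) (h1 : θ ≤ 1) :
    (coupling G θ).map Prod.snd = G.withDensity (raisedDensity G θ) := by
  refine Measure.ext_of_lintegral _ fun f hf => ?_
  have hIic : Measurable fun y => G (Set.Iic y) :=
    Monotone.measurable fun _ _ h => measure_mono (Set.Iic_subset_Iic.2 h)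
  have hm : Measurable fun y => 2 * G (Set.Iic y) * f y := (hIic.const_mul 2).mul hf
  rw [lintegral_map hf measurable_snd, lintegral_coupling (by fun_prop), lintegral_max hf,
    lintegral_withDensity_eq_lintegral_mul _ measurable_raisedDensity hf,
    ← lintegral_const_mul _ hf, ← lintegral_const_mul _ hm,
    ← lintegral_add_left (hf.const_mul _)]
  refine lintegral_congr fun y => ?_
  have hy : raisedDensity G θ y =
      ENNReal.ofReal (1 - θ) + ENNReal.ofReal θ * (2 * G (Set.Iic y)) := by
    rw [raisedDensity, centredCDF, ← ofReal_measureReal, ← ENNReal.ofReal_ofNat,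
      ← ENNReal.ofReal_mul (by norm_num), ← ENNReal.ofReal_mul h0,
      ← ENNReal.ofReal_add (by linarith) (by positivity)]
    congr 1; ring
  rw [Pi.mul_apply, hy]
  ring

lemma integral_centredCDF [NullSingletonClass G] : ∫ x, centredCDF G x ∂G = 0 := by
  have h := lintegral_max (G := G) (f := 1) measurable_one
  simp only [Pi.one_apply, lintegral_const, measure_univ, mul_one] at h
  have hint : Integrable (fun x => G.real (Set.Iic x)) G :=
    Integrable.of_bound measurable_measureReal_Iic.aestronglyMeasurable 1
      (ae_of_all _ fun x => by
        rw [Real.norm_of_nonneg measureReal_nonneg]; exact measureReal_le_one)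
  have h2 : ∫ x, 2 * G.real (Set.Iic x) ∂G = 1 := by
    rw [integral_eq_lintegral_of_nonneg_ae (ae_of_all _ fun x => by positivity)
      (measurable_measureReal_Iic.const_mul 2).aestronglyMeasurable]
    have : ∀ x, ENNReal.ofReal (2 * G.real (Set.Iic x)) = 2 * G (Set.Iic x) := fun x => by
      rw [ENNReal.ofReal_mul (by norm_num), ofReal_measureReal, ENNReal.ofReal_ofNat]
    simp_rw [this, ← h]; simp
  simp only [centredCDF]
  rw [integral_sub (hint.const_mul 2) (integrable_const _), h2]
  simp

lemma half_le_one_add_mul_centredCDF (h0 : 0 ≤ θ) (h1 : θ ≤ 1 / 2) (x : ℝ) :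
    1 / 2 ≤ 1 + θ * centredCDF G x := by
  have := abs_le.1 (abs_centredCDF_le (G := G) x)
  nlinarith

lemma raisedDensity_ne_zero (h0 : 0 ≤ θ) (h1 : θ ≤ 1 / 2) (x : ℝ) : raisedDensity G θ x ≠ 0 := by
  have := half_le_one_add_mul_centredCDF (G := G) h0 h1 x
  rw [raisedDensity, Ne, ENNReal.ofReal_eq_zero]
  linarith

/-- The linear term in `θ` vanishes because the perturbation of the density is centred. -/
lemma lintegral_inv_raisedDensity_sq_le [NullSingletonClass G] (h0 : 0 ≤ θ) (h1 : θ ≤ 1 / 2) :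
    ∫⁻ x, (raisedDensity G θ x)⁻¹ ^ 2 ∂G ≤ ENNReal.ofReal (1 + 8 * θ ^ 2) := by
  have hbound : ∀ x, (raisedDensity G θ x)⁻¹ ^ 2 ≤
      ENNReal.ofReal (1 + 8 * θ ^ 2 - 2 * θ * centredCDF G x) := by
    intro x
    have hc := abs_le.1 (abs_centredCDF_le (G := G) x)
    set c := centredCDF G x with hcdef
    have hhalf := half_le_one_add_mul_centredCDF (G := G) h0 h1 x
    rw [← hcdef] at hhalf
    have hpos : 0 < 1 + θ * c := by linarith
    rw [raisedDensity, ← hcdef, ← ENNReal.ofReal_inv_of_pos hpos,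
      ← ENNReal.ofReal_pow (inv_nonneg.2 hpos.le)]
    refine ENNReal.ofReal_le_ofReal ?_
    rw [inv_pow, inv_le_iff_one_le_mul₀ (by positivity)]
    have hu : -(1 / 2) ≤ θ * c := by linarith
    have hcθ : (θ * c) ^ 2 ≤ θ ^ 2 := by
      rw [mul_pow]
      have : c ^ 2 ≤ 1 := by nlinarith
      nlinarith [sq_nonneg θ]
    -- `(1 + u)² (1 - 2 u + 8 u²) - 1 = u² (1 + 2 u) (5 + 4 u)`
    nlinarith [mul_nonneg (sq_nonneg (θ * c)) (mul_nonneg (by linarith : 0 ≤ 1 + 2 * (θ * c))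
      (by linarith : 0 ≤ 5 + 4 * (θ * c))), mul_nonneg (sub_nonneg.2 hcθ) (sq_nonneg (1 + θ * c))]
  have hint : Integrable (centredCDF G) G :=
    Integrable.of_bound measurable_centredCDF.aestronglyMeasurable 1
      (ae_of_all _ fun x => abs_centredCDF_le x)
  refine (lintegral_mono hbound).trans ?_
  rw [← ofReal_integral_eq_lintegral_ofReal]
  · rw [integral_sub (integrable_const _) (hint.const_mul _), integral_const_mul,
      integral_centredCDF]
    simp
  · exact (integrable_const _).sub (hint.const_mul _)
  · refine ae_of_all _ fun x => ?_
    have hc := abs_le.1 (abs_centredCDF_le (G := G) x)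
    change 0 ≤ _
    nlinarith [sq_nonneg θ]

/-- Given the raised weight `x`, the expected increment is at least of order `θ` unless `x` is close
to the bottom of the support. -/
lemma le_lintegral_coupling_increment (h0 : 0 ≤ θ) (h1 : θ ≤ 1) {c δ : ℝ} (hδ : 0 ≤ δ)
    {H : ℝ → ℝ≥0∞} (hH : Measurable H) :
    ENNReal.ofReal θ * (ENNReal.ofReal δ * G (Set.Iic (c - δ))) *
        ∫⁻ q, (Set.Ioi c).indicator H q.2 ∂coupling G θ ≤
      2 * ∫⁻ q, H q.2 * ENNReal.ofReal (q.2 - q.1) ∂coupling G θ := by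
  set ψ := ENNReal.ofReal δ * G (Set.Iic (c - δ))
  have hI : Measurable ((Set.Ioi c).indicator H) := hH.indicator measurableSet_Ioi
  have hup : ∫⁻ q, (Set.Ioi c).indicator H q.2 ∂coupling G θ ≤
      2 * ∫⁻ y, (Set.Ioi c).indicator H y ∂G := by
    rw [lintegral_coupling (by fun_prop)]
    have h2 : ∫⁻ y, ∫⁻ y', (Set.Ioi c).indicator H (max y y') ∂G ∂G ≤
        2 * ∫⁻ y, (Set.Ioi c).indicator H y ∂G := by
      calc _ ≤ ∫⁻ y, ∫⁻ y', ((Set.Ioi c).indicator H y + (Set.Ioi c).indicator H y') ∂G ∂G := by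
            refine lintegral_mono fun y => lintegral_mono fun y' => ?_
            rcases max_choice y y' with h | h <;> rw [h]
            · exact le_self_add
            · exact le_add_self
        _ = 2 * ∫⁻ y, (Set.Ioi c).indicator H y ∂G := by
            simp_rw [lintegral_add_left measurable_const]
            rw [lintegral_add_right _ measurable_const]
            simp [two_mul]
    calc _ ≤ ENNReal.ofReal (1 - θ) * (2 * ∫⁻ y, (Set.Ioi c).indicator H y ∂G) +
          ENNReal.ofReal θ * (2 * ∫⁻ y, (Set.Ioi c).indicator H y ∂G) := by
          gcongr
          rw [two_mul]; exact le_self_add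
      _ = _ := by rw [← add_mul, ofReal_one_sub_add h0 h1, one_mul]
  have hlow : ENNReal.ofReal θ * (ψ * ∫⁻ y, (Set.Ioi c).indicator H y ∂G) ≤
      ∫⁻ q, H q.2 * ENNReal.ofReal (q.2 - q.1) ∂coupling G θ := by
    rw [lintegral_coupling (by fun_prop)]
    refine le_add_left ?_
    gcongr
    rw [lintegral_lintegral_swap (by fun_prop), ← lintegral_const_mul _ hI]
    refine lintegral_mono fun y' => ?_
    by_cases hy' : y' ∈ Set.Ioi c
    · rw [Set.indicator_of_mem hy', mul_right_comm, ← lintegral_indicator_const measurableSet_Iic]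
      refine lintegral_mono fun y => ?_
      by_cases hy : y ∈ Set.Iic (c - δ)
      · rw [Set.indicator_of_mem hy, mul_comm]
        have hy1 : y ≤ c - δ := hy
        have hy2 : c < y' := hy'
        rw [max_eq_right (by linarith)]
        gcongr
        linarith
      · simp [Set.indicator_of_notMem hy]
    · simp [Set.indicator_of_notMem hy']
  calc _ ≤ ENNReal.ofReal θ * ψ * (2 * ∫⁻ y, (Set.Ioi c).indicator H y ∂G) := by gcongr
    _ = 2 * (ENNReal.ofReal θ * (ψ * ∫⁻ y, (Set.Ioi c).indicator H y ∂G)) := by ring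
    _ ≤ _ := by gcongr

/-- Given the original weight, the expected increment is at most of order `θ`. -/
lemma lintegral_coupling_increment_le {a b : ℝ} (hG : ∀ᵐ x ∂G, x ∈ Set.Icc a b)
    {H : ℝ → ℝ≥0∞} (hH : Measurable H) :
    ∫⁻ q, H q.1 * ENNReal.ofReal (q.2 - q.1) ∂coupling G θ ≤
      ENNReal.ofReal θ * ENNReal.ofReal (b - a) * ∫⁻ y, H y ∂G := by
  rw [lintegral_coupling (by fun_prop)]
  simp only [sub_self, ENNReal.ofReal_zero, mul_zero, lintegral_zero, zero_add]
  rw [mul_assoc]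
  gcongr
  rw [← lintegral_const_mul _ hH]
  refine lintegral_mono_ae ?_
  filter_upwards [hG] with y hy
  rw [lintegral_const_mul _ (by fun_prop), mul_comm]
  gcongr
  calc ∫⁻ y', ENNReal.ofReal (max y y' - y) ∂G ≤ ∫⁻ _, ENNReal.ofReal (b - a) ∂G := by
        refine lintegral_mono_ae ?_
        filter_upwards [hG] with y' hy'
        gcongr
        · exact max_le hy.2 hy'.2
        · exact hy.1
    _ = _ := by simp

end Coupling

/-! ### Random environments -/

lemma countable_walk (u v : Fin d → ℤ) : Countable ((lattice d).Walk u v) :=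
  Function.Injective.countable (f := fun p : (lattice d).Walk u v => p.support)
    fun _ _ h => SimpleGraph.Walk.ext_support h

instance countable_latticePath (u v : Fin d → ℤ) : Countable (LatticePath u v) :=
  have := countable_walk u v
  inferInstanceAs (Countable {p : (lattice d).Walk u v // p.IsPath})

lemma measurable_pathTime {u v : Fin d → ℤ} (p : LatticePath u v) :
    Measurable fun t : Edge d → ℝ => pathTime t p :=
  Finset.measurable_sum _ fun e _ => measurable_pi_apply e

lemma measurable_passageTime (u v : Fin d → ℤ) :
    Measurable fun t : Edge d → ℝ => passageTime t u v :=
  Measurable.iInf measurable_pathTime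

lemma measurableSet_mem_geodesicEdges (u v : Fin d → ℤ) (e : Edge d) :
    MeasurableSet {t : Edge d → ℝ | e ∈ geodesicEdges t u v} := by
  have : {t : Edge d → ℝ | e ∈ geodesicEdges t u v} =
      ⋃ p : LatticePath u v, {t | pathTime t p = passageTime t u v} ∩ {_t | e ∈ pathEdges p} := by
    ext t; simp [geodesicEdges, IsGeodesic]
  rw [this]
  exact .iUnion fun p => (measurableSet_eq_fun (measurable_pathTime p)
    (measurable_passageTime u v)).inter (.const _)

/-- An environment with weights in `[a, b]` in which all geodesics are unique. -/
def Regular (a b : ℝ) (t : Edge d → ℝ) : Prop :=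
  InRange a b t ∧ ∀ u v : Fin d → ℤ, ∃! p : LatticePath u v, IsGeodesic t p

section Regular

variable (ν : Edge d → Measure ℝ) [∀ e, IsProbabilityMeasure (ν e)]

lemma ae_infinitePi_of_forall {ι : Type*} [Countable ι] {E : ι → Type*}
    [∀ i, MeasurableSpace (E i)] (ν : ∀ i, Measure (E i)) [∀ i, IsProbabilityMeasure (ν i)]
    {p : ∀ i, E i → Prop} (h : ∀ i, ∀ᵐ y ∂ν i, p i y) :
    ∀ᵐ x ∂Measure.infinitePi ν, ∀ i, p i (x i) :=
  ae_all_iff.2 fun i => (measurePreserving_eval_infinitePi ν i).quasiMeasurePreserving.ae (h i)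

/-- With independent atomless weights, two different finite edge sets almost surely have different
total weights. -/
lemma ae_sum_ne (hν : ∀ e x, ν e {x} = 0) {S T : Finset (Edge d)} (hST : ¬ S ⊆ T) :
    ∀ᵐ t ∂Measure.infinitePi ν, ∑ e ∈ S, t e ≠ ∑ e ∈ T, t e := by
  classical
  obtain ⟨e, heS, heT⟩ := Finset.not_subset.1 hST
  have hmeas : MeasurableSet {t : Edge d → ℝ | ∑ e ∈ S, t e = ∑ e ∈ T, t e} :=
    measurableSet_eq_fun (Finset.measurable_sum _ fun e _ => measurable_pi_apply e)
      (Finset.measurable_sum _ fun e _ => measurable_pi_apply e)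
  have h0 : Measure.infinitePi ν {t : Edge d → ℝ | ∑ e ∈ S, t e = ∑ e ∈ T, t e} = 0 := by
    rw [← lintegral_indicator_one hmeas,
      lintegral_infinitePi_update ν e (measurable_one.indicator hmeas)]
    refine (lintegral_congr fun t => ?_).trans lintegral_zero
    have hsub : ∀ y, {t : Edge d → ℝ | ∑ e ∈ S, t e = ∑ e ∈ T, t e}.indicator
        (1 : (Edge d → ℝ) → ℝ≥0∞) (Function.update t e y) =
        ({∑ f ∈ T, t f - ∑ f ∈ S.erase e, t f} : Set ℝ).indicator 1 y := by
      intro y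
      have hS : ∑ f ∈ S, Function.update t e y f = y + ∑ f ∈ S.erase e, t f := by
        rw [← Finset.add_sum_erase _ _ heS, Function.update_self]
        congr 1
        exact Finset.sum_congr rfl fun f hf => by
          rw [Function.update_of_ne (Finset.ne_of_mem_erase hf)]
      have hT : ∑ f ∈ T, Function.update t e y f = ∑ f ∈ T, t f :=
        Finset.sum_congr rfl fun f hf => by
          rw [Function.update_of_ne (fun h : f = e => heT (h ▸ hf))]
      simp only [Set.indicator_apply, Set.mem_ofPred_eq, hS, hT, Set.mem_singleton_iff,
        eq_sub_iff_add_eq, Pi.one_apply]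
    simp_rw [hsub]
    rw [lintegral_indicator_one (measurableSet_singleton _), hν]
  rw [ae_iff]
  simpa using h0

lemma ae_regular {a b : ℝ} (ha : 0 < a) (hν : ∀ e x, ν e {x} = 0)
    (hab : ∀ e, ∀ᵐ x ∂ν e, x ∈ Set.Icc a b) : ∀ᵐ t ∂Measure.infinitePi ν, Regular a b t := by
  have h1 : ∀ᵐ t ∂Measure.infinitePi ν, InRange a b t := ae_infinitePi_of_forall ν hab
  have h2 : ∀ᵐ t ∂Measure.infinitePi ν, ∀ (S T : Finset (Edge d)), S ≠ T →
      ∑ e ∈ S, t e ≠ ∑ e ∈ T, t e := by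
    refine ae_all_iff.2 fun S => ae_all_iff.2 fun T => ?_
    by_cases hST : S = T
    · exact ae_of_all _ fun t h => absurd hST h
    · by_cases h : S ⊆ T
      · have h' : ¬ T ⊆ S := fun h' => hST (h.antisymm h')
        filter_upwards [ae_sum_ne ν hν h'] with t ht _
        exact ht.symm
      · filter_upwards [ae_sum_ne ν hν h] with t ht _
        exact ht
  filter_upwards [h1, h2] with t ht hne
  refine ⟨ht, fun u v => ?_⟩
  obtain ⟨p, hp⟩ := exists_geodesic ha ht u v
  refine ⟨p, hp, fun q hq => ?_⟩
  by_contra hqp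
  refine hne (pathEdges q) (pathEdges p) (fun h => hqp (Subtype.ext ?_)) (hq.trans hp.symm)
  exact eq_of_walkEdges_eq q.2 p.2 h

end Regular

/-- The law of the environment with independent weights of law `G`. -/
noncomputable def envMeasure (d : ℕ) (G : Measure ℝ) [IsProbabilityMeasure G] :
    Measure (Edge d → ℝ) :=
  Measure.infinitePi fun _ => G

instance (G : Measure ℝ) [IsProbabilityMeasure G] : IsProbabilityMeasure (envMeasure d G) :=
  inferInstanceAs (IsProbabilityMeasure (Measure.infinitePi _))

section Joint

variable (G : Measure ℝ) [IsProbabilityMeasure G]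

instance (θ : unitInterval) : IsProbabilityMeasure (coupling G θ) :=
  isProbabilityMeasure_coupling θ.2.1 θ.2.2

/-- The joint law of an environment and of the environment obtained from it by raising the weight
of each edge `e` independently with probability `θ e`. -/
noncomputable def jointMeasure (θ : Edge d → unitInterval) : Measure (Edge d → ℝ × ℝ) :=
  Measure.infinitePi fun e => coupling G (θ e)

instance (θ : Edge d → unitInterval) : IsProbabilityMeasure (jointMeasure G θ) :=
  inferInstanceAs (IsProbabilityMeasure (Measure.infinitePi _))

/-- The original environment. -/
def low (w : Edge d → ℝ × ℝ) : Edge d → ℝ := fun e => (w e).1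

/-- The raised environment. -/
def high (w : Edge d → ℝ × ℝ) : Edge d → ℝ := fun e => (w e).2

@[fun_prop] lemma measurable_low : Measurable (low (d := d)) := by unfold low; fun_prop

@[fun_prop] lemma measurable_high : Measurable (high (d := d)) := by unfold high; fun_prop

variable (θ : Edge d → unitInterval)

lemma map_low : (jointMeasure G θ).map low = envMeasure d G := by
  refine (Measure.infinitePi_map_pi _ (f := fun _ => Prod.fst) fun _ => measurable_fst).trans ?_
  simp only [map_fst_coupling (θ _).2.1 (θ _).2.2]
  rfl

instance isProbabilityMeasure_map_snd (s : unitInterval) :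
    IsProbabilityMeasure ((coupling G s).map Prod.snd) :=
  Measure.isProbabilityMeasure_map measurable_snd.aemeasurable

lemma map_high : (jointMeasure G θ).map high =
    Measure.infinitePi fun e => (coupling G (θ e)).map Prod.snd :=
  Measure.infinitePi_map_pi _ (f := fun _ => Prod.snd) fun _ => measurable_snd

variable {G θ} in
/-- Raising the weights of at most `1 / (4 s²)` edges with probability `s` cannot make an event
much less likely. -/
lemma envMeasure_pow_three_le [NullSingletonClass G] {s : unitInterval}
    (hs : (s : ℝ) ≤ 1 / 2) {B : Finset (Edge d)}
    (hB : ∀ e ∈ B, θ e = s) (hB' : ∀ e ∉ B, θ e = 0) (hcard : (s : ℝ) ^ 2 * B.card ≤ 1 / 4)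
    {F : Set (Edge d → ℝ)} (hF : MeasurableSet F) :
    envMeasure d G F ^ 3 ≤
      jointMeasure G θ (high ⁻¹' F) ^ 2 * ENNReal.ofReal (Real.exp 2) := by
  have hsnd : ∀ e, (coupling G (θ e)).map Prod.snd = G.withDensity (raisedDensity G (θ e)) :=
    fun e => map_snd_coupling (θ e).2.1 (θ e).2.2
  have hdens := withDensity_prod_infinitePi (fun _ : Edge d => G)
    (fun e => measurable_raisedDensity (G := G) (θ := θ e))
    (fun e => (coupling G (θ e)).map Prod.snd) hsnd B fun e he => by
      rw [hsnd, hB' e he]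
      exact (congrArg G.withDensity (raisedDensity_zero G)).trans withDensity_one
  have hθ : ∀ e, ((θ e : unitInterval) : ℝ) ≤ 1 / 2 := fun e => by
    by_cases he : e ∈ B
    · rw [hB e he]; exact hs
    · rw [hB' e he]; simp
  set Z : (Edge d → ℝ) → ℝ≥0∞ := fun x => ∏ e ∈ B, raisedDensity G (θ e) (x e) with hZ
  have hZm : Measurable Z := Finset.measurable_prod _ fun e _ =>
    measurable_raisedDensity.comp (measurable_pi_apply e)
  have h := measure_pow_three_le (envMeasure d G) hZm
    (fun x => Finset.prod_ne_zero_iff.2 fun e _ => raisedDensity_ne_zero (θ e).2.1 (hθ e) _)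
    (fun x => ENNReal.prod_ne_top fun e _ => ENNReal.ofReal_ne_top) hF
  have hhigh : (envMeasure d G).withDensity Z F = jointMeasure G θ (high ⁻¹' F) := by
    rw [← Measure.map_apply measurable_high hF, map_high, ← hdens]
    rfl
  rw [hhigh] at h
  refine h.trans ?_
  gcongr
  have hinv : ∀ x, (Z x)⁻¹ ^ 2 = ∏ e ∈ B, (raisedDensity G (θ e) (x e))⁻¹ ^ 2 := fun x => by
    rw [hZ, Finset.prod_pow, ENNReal.prod_inv_distrib]
    exact fun e _ f _ _ => .inl (raisedDensity_ne_zero (θ e).2.1 (hθ e) _)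
  simp_rw [hinv]
  rw [envMeasure, lintegral_prod_infinitePi (fun _ : Edge d => G) B
    (f := fun e y => (raisedDensity G (θ e) y)⁻¹ ^ 2)
    fun e => measurable_raisedDensity.inv.pow_const 2]
  calc ∏ e ∈ B, ∫⁻ y, (raisedDensity G (θ e) y)⁻¹ ^ 2 ∂G
      ≤ ∏ _e ∈ B, ENNReal.ofReal (Real.exp (8 * (s : ℝ) ^ 2)) := by
        refine Finset.prod_le_prod' fun e he => ?_
        refine (lintegral_inv_raisedDensity_sq_le (θ e).2.1 (hθ e)).trans ?_
        rw [hB e he]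
        refine ENNReal.ofReal_le_ofReal ?_
        rw [add_comm]
        exact Real.add_one_le_exp _
    _ = ENNReal.ofReal (Real.exp (8 * (s : ℝ) ^ 2 * B.card)) := by
        rw [Finset.prod_const, ← ENNReal.ofReal_pow (Real.exp_pos _).le, ← Real.exp_nat_mul]
        congr 2; ring
    _ ≤ ENNReal.ofReal (Real.exp 2) := by
        refine ENNReal.ofReal_le_ofReal (Real.exp_le_exp.2 ?_)
        linarith

variable {a b : ℝ}

lemma ae_regular_envMeasure [NullSingletonClass G] (ha : 0 < a) (hab : ∀ᵐ x ∂G, x ∈ Set.Icc a b) :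
    ∀ᵐ t ∂envMeasure d G, Regular a b t :=
  ae_regular (fun _ => G) ha (fun _ _ => measure_singleton _) fun _ => hab

lemma ae_regular_low [NullSingletonClass G] (ha : 0 < a) (hab : ∀ᵐ x ∂G, x ∈ Set.Icc a b) :
    ∀ᵐ w ∂jointMeasure G θ, Regular a b (low w) := by
  refine ae_of_ae_map measurable_low.aemeasurable ?_
  rw [map_low]
  exact ae_regular_envMeasure G ha hab

lemma ae_regular_high [NullSingletonClass G] (ha : 0 < a) (hab : ∀ᵐ x ∂G, x ∈ Set.Icc a b) :
    ∀ᵐ w ∂jointMeasure G θ, Regular a b (high w) := by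
  refine ae_of_ae_map measurable_high.aemeasurable ?_
  rw [map_high]
  have hac : ∀ e, (coupling G (θ e)).map Prod.snd ≪ G := fun e => by
    rw [map_snd_coupling (θ e).2.1 (θ e).2.2]
    exact withDensity_absolutelyContinuous _ _
  exact ae_regular _ ha (fun e x => hac e (measure_singleton x)) fun e => (hac e).ae_le hab

lemma ae_low_le_high : ∀ᵐ w ∂jointMeasure G θ, ∀ e, low w e ≤ high w e := by
  refine ae_infinitePi_of_forall (p := fun _ q => q.1 ≤ q.2) (fun e => coupling G (θ e)) fun e => ?_
  have hm : MeasurableSet {q : ℝ × ℝ | ¬ q.1 ≤ q.2} :=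
    (measurableSet_le measurable_fst measurable_snd).compl
  rw [ae_iff, ← lintegral_indicator_one hm, lintegral_coupling (measurable_one.indicator hm)]
  simp

lemma ae_low_eq_high : ∀ᵐ w ∂jointMeasure G θ, ∀ e, θ e = 0 → low w e = high w e := by
  refine ae_infinitePi_of_forall (p := fun e q => θ e = 0 → q.1 = q.2)
    (fun e => coupling G (θ e)) fun e => ?_
  by_cases he : θ e = 0
  · have hm : MeasurableSet {q : ℝ × ℝ | ¬ q.1 = q.2} :=
      (measurableSet_eq_fun measurable_fst measurable_snd).compl
    simp only [he, forall_const]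
    rw [ae_iff, ← lintegral_indicator_one hm, lintegral_coupling (measurable_one.indicator hm)]
    simp
  · exact ae_of_all _ fun _ h => absurd h he

open Classical in
lemma low_update (w : Edge d → ℝ × ℝ) (e : Edge d) (q : ℝ × ℝ) :
    low (Function.update w e q) = Function.update (low w) e q.1 := by
  ext f
  by_cases h : f = e
  · subst h; simp [low]
  · simp [low, h]

open Classical in
lemma high_update (w : Edge d → ℝ × ℝ) (e : Edge d) (q : ℝ × ℝ) :
    high (Function.update w e q) = Function.update (high w) e q.2 := by
  ext f
  by_cases h : f = e
  · subst h; simp [high]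
  · simp [high, h]

/-- Conditionally on the raised environment, the expected increment at an edge whose raised weight
exceeds `c` is at least of order `θ e`. -/
lemma le_lintegral_increment {c δ : ℝ} (hδ : 0 ≤ δ) (e : Edge d) {h : (Edge d → ℝ) → ℝ≥0∞}
    (hh : Measurable h) :
    ENNReal.ofReal (θ e) * (ENNReal.ofReal δ * G (Set.Iic (c - δ))) *
        ∫⁻ w, {t : Edge d → ℝ | c < t e}.indicator h (high w) ∂jointMeasure G θ ≤
      2 * ∫⁻ w, h (high w) * ENNReal.ofReal (high w e - low w e) ∂jointMeasure G θ := by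
  classical
  have hset : MeasurableSet {t : Edge d → ℝ | c < t e} :=
    measurableSet_lt measurable_const (measurable_pi_apply e)
  have hm1 : Measurable fun w : Edge d → ℝ × ℝ =>
      {t : Edge d → ℝ | c < t e}.indicator h (high w) :=
    (hh.indicator hset).comp measurable_high
  have hm2 : Measurable fun w : Edge d → ℝ × ℝ =>
      h (high w) * ENNReal.ofReal (high w e - low w e) := by
    unfold high low; fun_prop
  rw [jointMeasure, lintegral_infinitePi_update _ e hm1, lintegral_infinitePi_update _ e hm2,
    ← lintegral_const_mul' _ _ (by finiteness), ← lintegral_const_mul' _ _ (by simp)]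
  refine lintegral_mono fun w => ?_
  have hH : Measurable fun y => h (Function.update (high w) e y) :=
    hh.comp (measurable_update _)
  have key := le_lintegral_coupling_increment (G := G) (θ e).2.1 (θ e).2.2 (c := c) hδ hH
  refine le_trans (le_of_eq ?_) (key.trans (le_of_eq ?_))
  · congr 1
    refine lintegral_congr fun q => ?_
    rw [high_update]
    simp [Set.indicator_apply]
  · congr 1
    refine lintegral_congr fun q => ?_
    simp [high_update, low_update]

/-- Conditionally on the original environment, the expected increment at `e` is at most of order
`θ e`. -/
lemma lintegral_increment_le (hab : ∀ᵐ x ∂G, x ∈ Set.Icc a b) (e : Edge d)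
    {h : (Edge d → ℝ) → ℝ≥0∞} (hh : Measurable h) :
    ∫⁻ w, h (low w) * ENNReal.ofReal (high w e - low w e) ∂jointMeasure G θ ≤
      ENNReal.ofReal (θ e) * ENNReal.ofReal (b - a) * ∫⁻ t, h t ∂envMeasure d G := by
  classical
  have hm2 : Measurable fun w : Edge d → ℝ × ℝ =>
      h (low w) * ENNReal.ofReal (high w e - low w e) := by
    unfold high low; fun_prop
  have hm1 : Measurable fun w : Edge d → ℝ × ℝ => h (low w) := hh.comp measurable_low
  rw [← map_low G θ, lintegral_map hh measurable_low, jointMeasure,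
    lintegral_infinitePi_update _ e hm2, lintegral_infinitePi_update _ e hm1,
    ← lintegral_const_mul' _ _ (by finiteness)]
  refine lintegral_mono fun w => ?_
  have hH : Measurable fun y => h (Function.update (low w) e y) :=
    hh.comp (measurable_update _)
  have key := lintegral_coupling_increment_le (G := G) (θ := θ e) hab hH
  rw [← lintegral_coupling_fst (θ e).2.1 (θ e).2.2 hH] at key
  refine le_trans (le_of_eq ?_) (key.trans (le_of_eq ?_))
  · refine lintegral_congr fun q => ?_
    simp [high_update, low_update]
  · simp only [low_update]

end Joint

/-! ### Translation averages -/

section Translation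

variable (G : Measure ℝ) [IsProbabilityMeasure G]

lemma map_shift_envMeasure (x : Fin d → ℤ) :
    (envMeasure d G).map (fun t e => t (shiftEdge x e)) = envMeasure d G := by
  classical
  refine Measure.eq_infinitePi _ fun s t ht => ?_
  have hm : Measurable fun (t : Edge d → ℝ) e => t (shiftEdge x e) :=
    measurable_pi_lambda _ fun e => measurable_pi_apply _
  rw [Measure.map_apply hm (.pi s.countable_toSet fun _ _ => ht _)]
  have hpre : (fun (t : Edge d → ℝ) e => t (shiftEdge x e)) ⁻¹' (Set.pi s t) =
      Set.pi (s.map (shiftEdge x).toEmbedding : Finset (Edge d))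
        fun e => t ((shiftEdge x).symm e) := by
    ext u
    simp only [Set.mem_preimage, Set.mem_pi, Finset.mem_coe, Finset.mem_map_equiv]
    exact (shiftEdge x).forall_congr fun {e} => by rw [Equiv.symm_apply_apply]
  rw [hpre, envMeasure, Measure.infinitePi_pi _ fun e _ => ht _, Finset.prod_map]
  simp

lemma shiftEdge_injective (e : Edge d) :
    Function.Injective fun x : Fin d → ℤ => (shiftEdge x).symm e := by
  intro x x' h
  obtain ⟨f, rfl⟩ := (shiftEdge x).surjective e
  simp only [Equiv.symm_apply_apply] at h
  rw [Equiv.eq_symm_apply] at h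
  obtain ⟨f, hf⟩ := f
  induction f with | _ y z =>
  have h' : s(y + x', z + x') = s(y + x, z + x) := congrArg Subtype.val h
  rcases Sym2.eq_iff.1 h' with ⟨h1, -⟩ | ⟨h1, h2⟩
  · exact (add_left_cancel h1).symm
  · ext i
    have e1 := congrFun h1 i
    have e2 := congrFun h2 i
    simp only [Pi.add_apply] at e1 e2
    omega

variable {G} [NullSingletonClass G] {a b : ℝ}

lemma envMeasure_mem_geodesicEdges_shift_le (ha : 0 < a) (hab : ∀ᵐ x ∂G, x ∈ Set.Icc a b)
    (f : Edge d) (x u v : Fin d → ℤ) :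
    envMeasure d G {t | f ∈ geodesicEdges t (u + x) (v + x)} ≤
      envMeasure d G {t | (shiftEdge x).symm f ∈ geodesicEdges t u v} := by
  have hm : Measurable fun (t : Edge d → ℝ) e => t (shiftEdge x e) :=
    measurable_pi_lambda _ fun e => measurable_pi_apply _
  conv_rhs => rw [← map_shift_envMeasure G x,
    Measure.map_apply hm (measurableSet_mem_geodesicEdges _ _ _)]
  refine measure_mono_ae ?_
  filter_upwards [ae_regular_envMeasure G ha hab] with t ht hf
  obtain ⟨q, hq⟩ := exists_geodesic (t := fun e => t (shiftEdge x e)) ha (fun e => ht.1 _) u v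
  have hgeo := isGeodesic_shiftPath (ht.1.nonneg ha) x hq
  change f ∈ geodesicEdges t _ _ at hf
  rw [geodesicEdges_eq (ht.2 _ _) hgeo, pathEdges_shiftPath, Finset.mem_coe,
    Finset.mem_map_equiv] at hf
  exact ⟨q, hq, hf⟩

/-- The geodesics between the translates of two points by the vectors of a cube of radius `r` visit
a given edge at most `O(r)` times on average, since the geodesic between the points themselves
spends at most that long in a cube of radius `r`. -/
lemma sum_envMeasure_shift_le (ha : 0 < a) (hb : 0 < b) (hab : ∀ᵐ x ∂G, x ∈ Set.Icc a b)
    (f : Edge d) (u v : Fin d → ℤ) (r : ℕ) :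
    ∑ x ∈ box 0 r, envMeasure d G {t | f ∈ geodesicEdges t (u + x) (v + x)} ≤
      ENNReal.ofReal (b * (2 * (r + 1) * d) / a) := by
  classical
  calc ∑ x ∈ box 0 r, envMeasure d G {t | f ∈ geodesicEdges t (u + x) (v + x)}
      ≤ ∑ x ∈ box 0 r, envMeasure d G {t | (shiftEdge x).symm f ∈ geodesicEdges t u v} :=
        Finset.sum_le_sum fun x _ => envMeasure_mem_geodesicEdges_shift_le ha hab f x u v
    _ = ∫⁻ t, ∑ x ∈ box 0 r, {t | (shiftEdge x).symm f ∈ geodesicEdges t u v}.indicator 1 t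
          ∂envMeasure d G := by
        rw [lintegral_finsetSum _ fun x _ =>
          measurable_one.indicator (measurableSet_mem_geodesicEdges _ _ _)]
        exact Finset.sum_congr rfl fun x _ =>
          (lintegral_indicator_one (measurableSet_mem_geodesicEdges _ _ _)).symm
    _ ≤ ∫⁻ _, ENNReal.ofReal (b * (2 * (r + 1) * d) / a) ∂envMeasure d G := by
        refine lintegral_mono_ae ?_
        filter_upwards [ae_regular_envMeasure G ha hab] with t ht
        obtain ⟨p, hp⟩ := exists_geodesic ha ht.1 u v
        have hcount : ∑ x ∈ box 0 r,
            {t | (shiftEdge x).symm f ∈ geodesicEdges t u v}.indicator (1 : (Edge d → ℝ) → ℝ≥0∞) t =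
            ((box 0 r).filter fun x => (shiftEdge x).symm f ∈ pathEdges p).card := by
          rw [Finset.card_filter]
          push_cast
          refine Finset.sum_congr rfl fun x _ => ?_
          rw [Set.indicator_apply]
          simp only [Set.mem_ofPred_eq, geodesicEdges_eq (ht.2 u v) hp, Finset.mem_coe,
            Pi.one_apply]
        rw [hcount, ← ENNReal.ofReal_natCast]
        refine ENNReal.ofReal_le_ofReal ?_
        rw [le_div_iff₀ ha, mul_comm]
        refine le_trans ?_ (card_geodesic_inter_boxEdges_le ha hb ht.1 hp (base f) r)
        gcongr
        rw [← Finset.card_image_of_injective _ (shiftEdge_injective f)]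
        refine Finset.card_le_card fun e he => ?_
        obtain ⟨x, hx, rfl⟩ := Finset.mem_image.1 he
        rw [Finset.mem_filter, mem_box] at hx
        refine Finset.mem_inter.2 ⟨hx.2, mem_boxEdges.2 ⟨base f - x, ?_, mem_box.2 fun i => ?_⟩⟩
        · rw [← mem_shiftEdge, Equiv.apply_symm_apply]
          exact base_mem f
        · have := hx.1 i
          simp only [Pi.zero_apply, Pi.sub_apply] at this ⊢
          omega
    _ = _ := by simp

end Translation

/-! ### The effect of raising the weights -/

open Classical in
/-- The number of edges of `B` of weight larger than `c` on the geodesic from `0` to `v`. -/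
noncomputable def heavyCount (c : ℝ) (B : Finset (Edge d)) (v : Fin d → ℤ) (t : Edge d → ℝ) : ℕ :=
  (B.filter fun f => f ∈ geodesicEdges t 0 v ∧ c < t f).card

lemma measurableSet_lt_weight (c : ℝ) (f : Edge d) :
    MeasurableSet {t : Edge d → ℝ | c < t f} :=
  measurableSet_lt measurable_const (measurable_pi_apply f)

open Classical in
lemma heavyCount_eq_sum (c : ℝ) (B : Finset (Edge d)) (v : Fin d → ℤ) (t : Edge d → ℝ) :
    (heavyCount c B v t : ℝ≥0∞) =
      ∑ f ∈ B, ({t | f ∈ geodesicEdges t 0 v} ∩ {t | c < t f}).indicator 1 t := by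
  rw [heavyCount, Finset.card_filter]
  push_cast
  refine Finset.sum_congr rfl fun f _ => ?_
  rw [Set.indicator_apply]
  rfl

lemma measurable_heavyCount (c : ℝ) (B : Finset (Edge d)) (v : Fin d → ℤ) :
    Measurable fun t => (heavyCount c B v t : ℝ≥0∞) := by
  simp_rw [heavyCount_eq_sum]
  exact Finset.measurable_sum _ fun f _ => measurable_one.indicator
    ((measurableSet_mem_geodesicEdges _ _ _).inter (measurableSet_lt_weight c f))

lemma measurableSet_le_heavyCount (c : ℝ) (B : Finset (Edge d)) (v : Fin d → ℤ) (y : ℝ) :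
    MeasurableSet {t | y ≤ heavyCount c B v t} := by
  have : {t | y ≤ heavyCount c B v t} =
      {t : Edge d → ℝ | ENNReal.ofReal y ≤ (heavyCount c B v t : ℝ≥0∞)} := by
    ext t
    rw [Set.mem_ofPred_eq, Set.mem_ofPred_eq, ← ENNReal.ofReal_natCast,
      ENNReal.ofReal_le_ofReal_iff (Nat.cast_nonneg _)]
  rw [this]
  exact measurableSet_le measurable_const (measurable_heavyCount c B v)

section Raise

variable {G : Measure ℝ} [IsProbabilityMeasure G] [NullSingletonClass G] {a b : ℝ}

open Classical in
lemma sum_ofReal_increments {B : Finset (Edge d)} {s t : Edge d → ℝ} (hst : ∀ e, s e ≤ t e)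
    (hB : ∀ e ∉ B, s e = t e) {u v : Fin d → ℤ} (p : LatticePath u v) :
    ∑ f ∈ B, (if f ∈ pathEdges p then 1 else 0) * ENNReal.ofReal (t f - s f) =
      ENNReal.ofReal (∑ f ∈ pathEdges p, (t f - s f)) := by
  rw [ENNReal.ofReal_sum_of_nonneg fun f _ => sub_nonneg.2 (hst f)]
  simp only [ite_mul, one_mul, zero_mul]
  rw [Finset.sum_ite_mem]
  refine Finset.sum_subset Finset.inter_subset_right fun f hf hfB => ?_
  rw [hB f fun h => hfB (Finset.mem_inter.2 ⟨h, hf⟩)]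
  simp

/-- Comparison, on the event `F`, of the increase of the passage time from `0` to `v` with the
increase of the passage time between the translates of these points by a vector `x`. -/
lemma lintegral_increments_le (ha : 0 < a) (hb : 0 < b) (hab : ∀ᵐ x ∂G, x ∈ Set.Icc a b)
    {θ : Edge d → unitInterval} {B : Finset (Edge d)} (hB : ∀ e ∉ B, θ e = 0)
    {F : Set (Edge d → ℝ)} (hF : MeasurableSet F) (v : Fin d → ℤ) {r : ℕ} {x : Fin d → ℤ}
    (hx : x ∈ box 0 r) :
    ∑ f ∈ B, ∫⁻ w, (F ∩ {t | f ∈ geodesicEdges t 0 v}).indicator 1 (high w) *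
        ENNReal.ofReal (high w f - low w f) ∂jointMeasure G θ ≤
      ∑ f ∈ B, ∫⁻ w, {t | f ∈ geodesicEdges t (0 + x) (v + x)}.indicator 1 (low w) *
        ENNReal.ofReal (high w f - low w f) ∂jointMeasure G θ +
      ENNReal.ofReal (8 * b * r * d) * jointMeasure G θ (high ⁻¹' F) := by
  classical
  have hmd : ∀ f : Edge d, Measurable fun w : Edge d → ℝ × ℝ =>
      ENNReal.ofReal (high w f - low w f) := fun f => by unfold high low; fun_prop
  have hm1 : ∀ f, Measurable fun w : Edge d → ℝ × ℝ =>
      (F ∩ {t | f ∈ geodesicEdges t 0 v}).indicator (1 : (Edge d → ℝ) → ℝ≥0∞) (high w) *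
        ENNReal.ofReal (high w f - low w f) := fun f =>
    ((measurable_one.indicator (hF.inter (measurableSet_mem_geodesicEdges _ _ _))).comp
      measurable_high).mul (hmd f)
  have hm2 : ∀ f, Measurable fun w : Edge d → ℝ × ℝ =>
      {t | f ∈ geodesicEdges t (0 + x) (v + x)}.indicator (1 : (Edge d → ℝ) → ℝ≥0∞) (low w) *
        ENNReal.ofReal (high w f - low w f) := fun f =>
    ((measurable_one.indicator (measurableSet_mem_geodesicEdges _ _ _)).comp
      measurable_low).mul (hmd f)
  rw [← lintegral_finsetSum _ fun f _ => hm1 f, ← lintegral_finsetSum _ fun f _ => hm2 f,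
    ← lintegral_indicator_const (measurable_high hF),
    ← lintegral_add_left (Finset.measurable_sum _ fun f _ => hm2 f)]
  refine lintegral_mono_ae ?_
  filter_upwards [ae_regular_low G θ ha hab, ae_regular_high G θ ha hab, ae_low_le_high G θ,
    ae_low_eq_high G θ] with w hlow hhigh hle heq
  by_cases hwF : high w ∈ F
  swap
  · have : ∀ f, (F ∩ {t | f ∈ geodesicEdges t 0 v}).indicator
        (1 : (Edge d → ℝ) → ℝ≥0∞) (high w) = 0 :=
      fun f => Set.indicator_of_notMem (fun h => hwF h.1) _
    simp [this]
  obtain ⟨p, hp⟩ := exists_geodesic ha hhigh.1 0 v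
  obtain ⟨q, hq⟩ := exists_geodesic ha hlow.1 (0 + x) (v + x)
  have h1 : ∀ f, (F ∩ {t | f ∈ geodesicEdges t 0 v}).indicator (1 : (Edge d → ℝ) → ℝ≥0∞) (high w) =
      if f ∈ pathEdges p then 1 else 0 := fun f => by
    rw [Set.indicator_apply]
    simp only [Set.mem_inter_iff, hwF, true_and, Set.mem_ofPred_eq,
      geodesicEdges_eq (hhigh.2 _ _) hp, Finset.mem_coe, Pi.one_apply]
  have h2 : ∀ f, {t | f ∈ geodesicEdges t (0 + x) (v + x)}.indicator
      (1 : (Edge d → ℝ) → ℝ≥0∞) (low w) =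
      if f ∈ pathEdges q then 1 else 0 := fun f => by
    rw [Set.indicator_apply]
    simp only [Set.mem_ofPred_eq, geodesicEdges_eq (hlow.2 _ _) hq, Finset.mem_coe, Pi.one_apply]
  have hoff : ∀ e ∉ B, low w e = high w e := fun e he => heq e (hB e he)
  simp only [h1, h2]
  rw [sum_ofReal_increments hle hoff, sum_ofReal_increments hle hoff,
    Set.indicator_of_mem (show w ∈ high ⁻¹' F from hwF),
    ← ENNReal.ofReal_add (Finset.sum_nonneg fun f _ => sub_nonneg.2 (hle f)) (by positivity)]
  refine ENNReal.ofReal_le_ofReal ((sum_increments_le ha hb hlow.1 hhigh.1 hp hq).trans ?_)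
  have hl1 : (l1 0 (0 + x) : ℝ) ≤ 2 * r * d := by
    exact_mod_cast l1_le_of_mem_box (mem_box_of_l1_le ((l1_self 0).trans_le r.zero_le))
      (show 0 + x ∈ box 0 r from (zero_add x).symm ▸ hx)
  have hl2 : l1 v (v + x) = l1 0 (0 + x) := by simp [l1]
  rw [hl2]
  have : b * (l1 0 (0 + x) : ℝ) ≤ b * (2 * r * d) := mul_le_mul_of_nonneg_left hl1 hb.le
  linarith

/-- Raising the weights on `B` lengthens the geodesic from `0` to `v` in
proportion to the number of heavy edges of `B` on it, whereas it hardly affects the geodesics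
between typical translates of `0` and `v` by vectors of length at most `r`; but the passage times differ by
at most `O(r)`. -/
lemma mul_prob_heavyCount_le (ha : 0 < a) (hb : a < b) (hab : ∀ᵐ x ∂G, x ∈ Set.Icc a b)
    {s : unitInterval} {θ : Edge d → unitInterval} {B : Finset (Edge d)}
    (hBs : ∀ e ∈ B, θ e = s) (hB : ∀ e ∉ B, θ e = 0) {c δ : ℝ} (hδ : 0 ≤ δ) (v : Fin d → ℤ)
    {y : ℝ} (hy : 0 ≤ y) (r : ℕ) :
    (2 * r + 1 : ℝ) ^ d * (s * (δ * G.real (Set.Iic (c - δ))) * (y *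
        (jointMeasure G θ).real (high ⁻¹' {t | y ≤ heavyCount c B v t}))) ≤
      2 * (s * (b - a) * (B.card * (b * (2 * (r + 1) * d) / a))) +
      (2 * r + 1 : ℝ) ^ d * (2 * ((8 * b * r * d) *
        (jointMeasure G θ).real (high ⁻¹' {t | y ≤ heavyCount c B v t}))) := by
  classical
  have hb0 : 0 < b := ha.trans hb
  set F := {t | y ≤ heavyCount c B v t} with hFdef
  have hF : MeasurableSet F := measurableSet_le_heavyCount c B v y
  set Q := jointMeasure G θ with hQ
  set κ := ENNReal.ofReal δ * G (Set.Iic (c - δ)) with hκ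
  set I : ℝ≥0∞ := ∑ f ∈ B, ∫⁻ w, (F ∩ {t | f ∈ geodesicEdges t 0 v}).indicator 1 (high w) *
        ENNReal.ofReal (high w f - low w f) ∂Q with hI
  have hlow : ENNReal.ofReal s * κ * (ENNReal.ofReal y * Q (high ⁻¹' F)) ≤ 2 * I := by
    have hstep : ∀ f ∈ B, ENNReal.ofReal s * κ * ∫⁻ w,
        (F ∩ {t | f ∈ geodesicEdges t 0 v} ∩ {t | c < t f}).indicator 1 (high w) ∂Q ≤
        2 * ∫⁻ w, (F ∩ {t | f ∈ geodesicEdges t 0 v}).indicator 1 (high w) *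
          ENNReal.ofReal (high w f - low w f) ∂Q := by
      intro f hf
      have h := le_lintegral_increment G θ (c := c) hδ f
        (measurable_one.indicator (hF.inter (measurableSet_mem_geodesicEdges 0 v f)))
      rw [hBs f hf] at h
      refine le_trans (le_of_eq ?_) h
      congr 1
      refine lintegral_congr fun w => ?_
      rw [Set.indicator_indicator, Set.inter_comm {t : Edge d → ℝ | c < t f}]
    rw [hI, Finset.mul_sum]
    refine le_trans ?_ (Finset.sum_le_sum hstep)
    rw [← Finset.mul_sum]
    gcongr
    have hm : ∀ f, Measurable fun w : Edge d → ℝ × ℝ =>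
        (F ∩ {t | f ∈ geodesicEdges t 0 v} ∩ {t | c < t f}).indicator
          (1 : (Edge d → ℝ) → ℝ≥0∞) (high w) := fun f =>
      (measurable_one.indicator ((hF.inter (measurableSet_mem_geodesicEdges _ _ _)).inter
        (measurableSet_lt_weight c f))).comp measurable_high
    rw [← lintegral_finsetSum _ fun f _ => hm f, ← lintegral_indicator_const (measurable_high hF)]
    refine lintegral_mono fun w => ?_
    by_cases hwF : high w ∈ F
    · rw [Set.indicator_of_mem (show w ∈ high ⁻¹' F from hwF)]
      have h1 : ∀ f, (F ∩ {t | f ∈ geodesicEdges t 0 v} ∩ {t | c < t f}).indicator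
          (1 : (Edge d → ℝ) → ℝ≥0∞) (high w) =
          ({t | f ∈ geodesicEdges t 0 v} ∩ {t | c < t f}).indicator 1 (high w) := fun f => by
        simp only [Set.indicator_apply, Set.mem_inter_iff, hwF, true_and]
      simp only [h1]
      rw [← heavyCount_eq_sum, ← ENNReal.ofReal_natCast]
      exact ENNReal.ofReal_le_ofReal hwF
    · rw [Set.indicator_of_notMem (show w ∉ high ⁻¹' F from hwF)]
      exact zero_le
  have hup : ∀ x ∈ box (0 : Fin d → ℤ) r, I ≤ ENNReal.ofReal s * ENNReal.ofReal (b - a) *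
      ∑ f ∈ B, envMeasure d G {t | f ∈ geodesicEdges t (0 + x) (v + x)} +
      ENNReal.ofReal (8 * b * r * d) * Q (high ⁻¹' F) := by
    intro x hx
    refine (lintegral_increments_le ha hb0 hab hB hF v hx).trans ?_
    gcongr
    rw [Finset.mul_sum]
    refine Finset.sum_le_sum fun f hf => ?_
    have h := lintegral_increment_le G θ hab f
      (measurable_one.indicator (measurableSet_mem_geodesicEdges (0 + x) (v + x) f))
    rwa [lintegral_indicator_one (measurableSet_mem_geodesicEdges _ _ _), hBs f hf] at h
  have hsum : ((box (0 : Fin d → ℤ) r).card : ℝ≥0∞) * I ≤ ENNReal.ofReal s *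
      ENNReal.ofReal (b - a) * (B.card * ENNReal.ofReal (b * (2 * (r + 1) * d) / a)) +
      (box (0 : Fin d → ℤ) r).card * (ENNReal.ofReal (8 * b * r * d) * Q (high ⁻¹' F)) := by
    rw [← nsmul_eq_mul, ← Finset.sum_const]
    refine (Finset.sum_le_sum hup).trans ?_
    rw [Finset.sum_add_distrib, Finset.sum_const, nsmul_eq_mul, ← Finset.mul_sum,
      Finset.sum_comm]
    gcongr
    rw [← nsmul_eq_mul]
    exact Finset.sum_le_card_nsmul _ _ _ fun f _ =>
      sum_envMeasure_shift_le ha hb0 hab f 0 v r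
  have hfin : ((box (0 : Fin d → ℤ) r).card : ℝ≥0∞) *
      (ENNReal.ofReal s * κ * (ENNReal.ofReal y * Q (high ⁻¹' F))) ≤
      2 * (ENNReal.ofReal s *
      ENNReal.ofReal (b - a) * (B.card * ENNReal.ofReal (b * (2 * (r + 1) * d) / a))) +
      (box (0 : Fin d → ℤ) r).card *
        (2 * (ENNReal.ofReal (8 * b * r * d) * Q (high ⁻¹' F))) := by
    calc _ ≤ ((box (0 : Fin d → ℤ) r).card : ℝ≥0∞) * (2 * I) := by gcongr
      _ = 2 * ((box (0 : Fin d → ℤ) r).card * I) := by ring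
      _ ≤ _ := (mul_le_mul_right hsum 2).trans (le_of_eq (by ring))
  have hreal := ENNReal.toReal_mono (by finiteness) hfin
  rw [ENNReal.toReal_add (by finiteness) (by finiteness)] at hreal
  simp only [hκ, ENNReal.toReal_mul, ENNReal.toReal_natCast, ENNReal.toReal_ofNat,
    ENNReal.toReal_ofReal s.2.1, ENNReal.toReal_ofReal hδ, ENNReal.toReal_ofReal hy,
    ENNReal.toReal_ofReal (sub_nonneg.2 hb.le),
    ENNReal.toReal_ofReal (show 0 ≤ b * (2 * (r + 1) * d) / a by positivity),
    ENNReal.toReal_ofReal (show 0 ≤ 8 * b * r * d by positivity), card_box] at hreal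
  push_cast at hreal
  exact hreal

end Raise

/-! ### A level of the count of heavy edges -/

lemma le_add_sum_dyadic {h Y : ℝ} (hh : 0 < h) (J : ℕ) (hY : Y < 2 ^ J * h) :
    Y ≤ h + ∑ j ∈ Finset.range J, 2 ^ j * h * (if 2 ^ j * h ≤ Y then 1 else 0) := by
  induction J with
  | zero => simpa using hY.le
  | succ J ih =>
    by_cases hJ : Y < 2 ^ J * h
    · rw [Finset.sum_range_succ, if_neg (not_le.2 hJ)]
      simpa using ih hJ
    · have hall : ∀ j ∈ Finset.range (J + 1),
          2 ^ j * h * (if 2 ^ j * h ≤ Y then 1 else 0) = 2 ^ j * h := by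
        intro j hj
        have hj' : j ≤ J := Nat.lt_succ_iff.1 (Finset.mem_range.1 hj)
        have : (2 : ℝ) ^ j * h ≤ 2 ^ J * h := by gcongr; norm_num
        rw [if_pos (this.trans (not_lt.1 hJ)), mul_one]
      rw [Finset.sum_congr rfl hall, ← Finset.sum_mul, geom_sum_eq (by norm_num)]
      linarith

/-- A bounded random variable `Y` with mean `m > 0` exceeds some level `y ≥ m / 2` with probability
at least of order `(m / y) ^ (4 / 3)`; any exponent larger than `1` could be used. -/
lemma exists_level {Ω : Type*} [MeasurableSpace Ω] {μ : Measure Ω} [IsProbabilityMeasure μ]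
    {Y : Ω → ℝ} (hlev : ∀ y, MeasurableSet {x | y ≤ Y x}) (hint : Integrable Y μ) {M : ℝ}
    (hM : ∀ x, Y x ≤ M) (hm : 0 < ∫ x, Y x ∂μ) :
    ∃ y, (∫ x, Y x ∂μ) / 2 ≤ y ∧
      (∫ x, Y x ∂μ) ^ 4 ≤ 2000 * y ^ 4 * μ.real {x | y ≤ Y x} ^ 3 := by
  set m := ∫ x, Y x ∂μ with hmdef
  set h := m / 2 with hh
  have hh0 : 0 < h := by positivity
  obtain ⟨J, hJ⟩ := pow_unbounded_of_one_lt (M / h) (by norm_num : (1 : ℝ) < 2)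
  rw [div_lt_iff₀ hh0] at hJ
  have hex : ∃ j : ℕ, h * (1 / 5 * (4 / 5) ^ j) ≤ 2 ^ j * h * μ.real {x | 2 ^ j * h ≤ Y x} := by
    by_contra! hcon
    have hind : ∀ j : ℕ, Integrable (fun x => 2 ^ j * h * (if 2 ^ j * h ≤ Y x then 1 else 0)) μ :=
      fun j => Integrable.const_mul
        ((integrable_const (1 : ℝ)).indicator (hlev (2 ^ j * h))) (2 ^ j * h)
    have hle : m ≤ h + ∑ j ∈ Finset.range J, 2 ^ j * h * μ.real {x | 2 ^ j * h ≤ Y x} := by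
      have h1 := integral_mono (μ := μ) hint
        ((integrable_const h).add (integrable_finsetSum (Finset.range J) fun j _ => hind j))
        fun x => le_add_sum_dyadic hh0 J ((hM x).trans_lt hJ)
      refine h1.trans (le_of_eq ?_)
      rw [integral_add' (integrable_const h) (integrable_finsetSum _ fun j _ => hind j),
        integral_finsetSum _ fun j _ => hind j, integral_const]
      simp only [probReal_univ, one_smul]
      congr 1
      refine Finset.sum_congr rfl fun j _ => ?_
      rw [integral_const_mul]
      congr 1
      exact integral_indicator_one (hlev (2 ^ j * h))
    have hlt : ∑ j ∈ Finset.range J, 2 ^ j * h * μ.real {x | 2 ^ j * h ≤ Y x} ≤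
        ∑ j ∈ Finset.range J, h * (1 / 5 * (4 / 5) ^ j) :=
      Finset.sum_le_sum fun j _ => (hcon j).le
    rw [← Finset.mul_sum, ← Finset.mul_sum, geom_sum_eq (by norm_num)] at hlt
    have hgeom : (1 : ℝ) / 5 * (((4 / 5) ^ J - 1) / (4 / 5 - 1)) = 1 - (4 / 5) ^ J := by ring
    rw [hgeom] at hlt
    have : 0 < h * (4 / 5) ^ J := by positivity
    linarith
  obtain ⟨j, hj⟩ := hex
  refine ⟨2 ^ j * h, le_mul_of_one_le_left hh0.le (one_le_pow₀ (by norm_num)), ?_⟩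
  set p := μ.real {x | 2 ^ j * h ≤ Y x}
  have hp : 1 / 5 * (4 / 5) ^ j ≤ 2 ^ j * p := by
    refine le_of_mul_le_mul_left ?_ hh0
    linarith
  have hp3 := pow_le_pow_left₀ (by positivity) hp 3
  have h1 : (1 : ℝ) / 125 * (1 / 2) ^ j ≤ (1 / 5 * (4 / 5) ^ j) ^ 3 := by
    rw [mul_pow, ← pow_mul, mul_comm j 3, pow_mul]
    have : ((1 : ℝ) / 2) ^ j ≤ ((4 / 5) ^ 3) ^ j := pow_le_pow_left₀ (by norm_num) (by norm_num) j
    norm_num at this ⊢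
    linarith
  have h2 : (1 : ℝ) ≤ 125 * 2 ^ j * (2 ^ j * p) ^ 3 := by
    have h3 : (1 / 2 : ℝ) ^ j * 2 ^ j = 1 := by rw [← mul_pow]; norm_num
    have h4 : (0 : ℝ) < 2 ^ j := by positivity
    nlinarith [mul_le_mul_of_nonneg_left (h1.trans hp3) h4.le]
  calc m ^ 4 = 16 * h ^ 4 * 1 := by rw [hh]; ring
    _ ≤ 16 * h ^ 4 * (125 * 2 ^ j * (2 ^ j * p) ^ 3) := by gcongr
    _ = 2000 * (2 ^ j * h) ^ 4 * p ^ 3 := by ring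

/-! ### Optimizing over the scale of the translations -/

lemma exists_nat_pow_between {z : ℝ} (hz : 1 ≤ z) (n : ℕ) :
    ∃ r : ℕ, 1 ≤ r ∧ z ≤ (r : ℝ) ^ (n + 1) ∧ (r : ℝ) ^ (n + 1) ≤ 2 ^ (n + 1) * z := by
  classical
  have hex : ∃ r : ℕ, z ≤ (r : ℝ) ^ (n + 1) := by
    obtain ⟨r, hr⟩ := exists_nat_ge z
    exact ⟨r, hr.trans (le_self_pow₀ (hz.trans hr) (Nat.succ_ne_zero n))⟩
  have h1 := Nat.find_spec hex
  have h2 : ∀ k, k < Nat.find hex → ¬ z ≤ (k : ℝ) ^ (n + 1) := fun k => Nat.find_min hex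
  set r := Nat.find hex
  obtain ⟨k, hk⟩ : ∃ k, r = k + 1 := Nat.exists_eq_succ_of_ne_zero fun h0 => by
    rw [h0] at h1; norm_num at h1; linarith
  refine ⟨r, by omega, h1, ?_⟩
  rcases Nat.eq_zero_or_pos k with h0 | h0
  · rw [hk, h0]
    have : (1 : ℝ) ≤ 2 ^ (n + 1) := one_le_pow₀ (by norm_num)
    norm_num
    nlinarith
  · have hlt := not_le.1 (h2 k (by omega))
    have hk1 : (1 : ℝ) ≤ k := by exact_mod_cast h0
    calc (r : ℝ) ^ (n + 1) ≤ (2 * k) ^ (n + 1) := by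
          rw [hk]; push_cast; gcongr; linarith
      _ = 2 ^ (n + 1) * (k : ℝ) ^ (n + 1) := mul_pow _ _ _
      _ ≤ 2 ^ (n + 1) * z := by gcongr

/-- The radius `r` is chosen with `r ^ (d - 1)` of order `M y / m ^ 2`. -/
lemma pow_le_of_forall_radius {κ E₁ E₂ c₁ : ℝ} (hκ : 0 < κ) (hE₁ : 0 < E₁) (hE₂ : 0 < E₂)
    (hc₁ : 0 < c₁) (n : ℕ) :
    ∃ C : ℝ, 0 < C ∧ ∀ m M y π s : ℝ, 0 < m → m ≤ M → m / 2 ≤ y → c₁ * m ^ 2 ≤ π * y ^ 2 →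
      0 < s → s ^ 2 * M = 1 / 4 →
      (∀ r : ℕ, (2 * r + 1 : ℝ) ^ (n + 2) * (s * κ * (y * π)) ≤
        s * E₁ * M * (r + 1) + (2 * r + 1 : ℝ) ^ (n + 2) * (E₂ * r * π)) →
      m ^ (2 * (n + 2)) ≤ C * M ^ (n + 2 + 1) := by
  set D := max 2 (4 * E₁ / (κ * c₁)) with hD
  have hD0 : 0 < D := lt_of_lt_of_le two_pos (le_max_left _ _)
  set E := (16 * E₂ ^ 2) ^ (n + 1) * (2 ^ (n + 1) * D) ^ 2 with hE
  refine ⟨4 ^ n * E / κ ^ (2 * (n + 1)), by positivity, ?_⟩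
  intro m M y π s hm hmM hy hπ hs hsM hr
  have hy0 : 0 < y := lt_of_lt_of_le (by positivity) hy
  have hM : 0 < M := hm.trans_le hmM
  have hπ0 : 0 < π := by
    by_contra! h
    have : π * y ^ 2 ≤ 0 := mul_nonpos_of_nonpos_of_nonneg h (sq_nonneg y)
    have : 0 < c₁ * m ^ 2 := by positivity
    linarith
  set z := M * y / m ^ 2 with hz
  have hz0 : 0 < z := by positivity
  have hzhalf : 1 / 2 ≤ z := by
    rw [hz, le_div_iff₀ (by positivity)]
    nlinarith
  have hDz : 1 ≤ D * z := by
    have : (2 : ℝ) ≤ D := le_max_left _ _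
    nlinarith
  obtain ⟨r, hr1, hrlow, hrup⟩ := exists_nat_pow_between hDz n
  have hr1' : (1 : ℝ) ≤ r := by exact_mod_cast hr1
  have hrad := hr r
  -- With this radius the first term on the right is at most half of the left-hand side.
  have hfirst : s * E₁ * M * (r + 1) ≤
      1 / 2 * ((2 * r + 1 : ℝ) ^ (n + 2) * (s * κ * (y * π))) := by
    have h1 : 4 * E₁ * M ≤ r ^ (n + 1) * κ * (y * π) := by
      have h2 : 4 * E₁ ≤ D * (κ * c₁) := by
        rw [← div_le_iff₀ (by positivity)]; exact le_max_right _ _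
      have h3 : c₁ * m ^ 2 / y ≤ y * π := by
        rw [div_le_iff₀ hy0]; linarith
      calc 4 * E₁ * M ≤ D * (κ * c₁) * M := by gcongr
        _ = D * z * κ * (c₁ * m ^ 2 / y) := by rw [hz]; field_simp
        _ ≤ r ^ (n + 1) * κ * (y * π) := by gcongr
    have h4 : (r : ℝ) ^ (n + 2) ≤ (2 * r + 1 : ℝ) ^ (n + 2) := by gcongr; linarith
    calc s * E₁ * M * (r + 1) ≤ s * E₁ * M * (2 * r) := by gcongr; linarith
      _ = 1 / 2 * s * r * (4 * E₁ * M) := by ring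
      _ ≤ 1 / 2 * s * r * (r ^ (n + 1) * κ * (y * π)) := by gcongr
      _ = 1 / 2 * (r ^ (n + 2) * (s * κ * (y * π))) := by ring
      _ ≤ _ := by gcongr
  have hsy : s * κ * y ≤ 2 * E₂ * r := by
    have hpos : 0 < (2 * r + 1 : ℝ) ^ (n + 2) * π := by positivity
    refine le_of_mul_le_mul_left ?_ hpos
    linarith
  have hsq : κ ^ 2 * y ^ 2 ≤ 16 * E₂ ^ 2 * M * r ^ 2 := by
    have h1 := pow_le_pow_left₀ (by positivity) hsy 2
    calc κ ^ 2 * y ^ 2 = 4 * M * (s * κ * y) ^ 2 := by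
          rw [mul_pow, mul_pow]; linear_combination (-4 * κ ^ 2 * y ^ 2) * hsM
      _ ≤ 4 * M * (2 * E₂ * r) ^ 2 := by gcongr
      _ = _ := by ring
  have hpow : (κ ^ 2 * y ^ 2) ^ (n + 1) ≤ E * M ^ (n + 1) * z ^ 2 := by
    calc (κ ^ 2 * y ^ 2) ^ (n + 1) ≤ (16 * E₂ ^ 2 * M * r ^ 2) ^ (n + 1) := by gcongr
      _ = (16 * E₂ ^ 2) ^ (n + 1) * M ^ (n + 1) * (r ^ (n + 1)) ^ 2 := by
        rw [mul_pow, mul_pow]; ring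
      _ ≤ (16 * E₂ ^ 2) ^ (n + 1) * M ^ (n + 1) * (2 ^ (n + 1) * (D * z)) ^ 2 := by gcongr
      _ = _ := by rw [hE]; ring
  have hfin : κ ^ (2 * (n + 1)) * y ^ (2 * n) * m ^ 4 ≤ E * M ^ (n + 3) := by
    have hy2 : 0 < y ^ 2 := by positivity
    refine le_of_mul_le_mul_right ?_ hy2
    calc κ ^ (2 * (n + 1)) * y ^ (2 * n) * m ^ 4 * y ^ 2
        = (κ ^ 2 * y ^ 2) ^ (n + 1) * m ^ 4 := by rw [mul_pow, ← pow_mul, ← pow_mul]; ring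
      _ ≤ E * M ^ (n + 1) * z ^ 2 * m ^ 4 := by gcongr
      _ = E * M ^ (n + 3) * y ^ 2 := by rw [hz]; field_simp; ring
  rw [div_mul_eq_mul_div, le_div_iff₀ (by positivity)]
  have hmy : m ^ (2 * n) ≤ 4 ^ n * y ^ (2 * n) := by
    rw [pow_mul, pow_mul, ← mul_pow]
    gcongr
    nlinarith
  calc m ^ (2 * (n + 2)) * κ ^ (2 * (n + 1)) = m ^ (2 * n) * (κ ^ (2 * (n + 1)) * m ^ 4) := by ring
    _ ≤ 4 ^ n * y ^ (2 * n) * (κ ^ (2 * (n + 1)) * m ^ 4) := by gcongr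
    _ = 4 ^ n * (κ ^ (2 * (n + 1)) * y ^ (2 * n) * m ^ 4) := by ring
    _ ≤ 4 ^ n * (E * M ^ (n + 3)) := by gcongr
    _ = 4 ^ n * E * M ^ (n + 2 + 1) := by ring

section Count

variable {G : Measure ℝ} [IsProbabilityMeasure G] [NullSingletonClass G] {a b : ℝ}

lemma heavyCount_le (c : ℝ) (B : Finset (Edge d)) (v : Fin d → ℤ) (t : Edge d → ℝ) :
    heavyCount c B v t ≤ B.card := by
  classical exact Finset.card_filter_le _ _

lemma measurable_heavyCount_real (c : ℝ) (B : Finset (Edge d)) (v : Fin d → ℤ) :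
    Measurable fun t => (heavyCount c B v t : ℝ) :=
  (measurable_heavyCount c B v).ennreal_toReal

lemma integrable_heavyCount (μ : Measure (Edge d → ℝ)) [IsFiniteMeasure μ] (c : ℝ)
    (B : Finset (Edge d)) (v : Fin d → ℤ) : Integrable (fun t => (heavyCount c B v t : ℝ)) μ :=
  Integrable.of_bound (measurable_heavyCount_real c B v).aestronglyMeasurable B.card
    (ae_of_all _ fun t => by
      rw [Real.norm_of_nonneg (Nat.cast_nonneg _)]
      exact_mod_cast heavyCount_le c B v t)

/-- The expected number of heavy edges of a finite set `B` on the geodesic from `0` to `v` is at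
most of order `|B| ^ ((d + 1) / (2 d))`. -/
lemma integral_heavyCount_pow_le (hd : 2 ≤ d) (ha : 0 < a) (hb : a < b)
    (hab : ∀ᵐ x ∂G, x ∈ Set.Icc a b) {c δ : ℝ} (hδ : 0 < δ) (hG : 0 < G.real (Set.Iic (c - δ))) :
    ∃ C : ℝ, 0 < C ∧ ∀ (B : Finset (Edge d)) (v : Fin d → ℤ),
      (∫ t, (heavyCount c B v t : ℝ) ∂envMeasure d G) ^ (2 * d) ≤ C * (B.card : ℝ) ^ (d + 1) := by
  classical
  obtain ⟨n, rfl⟩ := Nat.exists_eq_add_of_le' hd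
  have hb0 : 0 < b := ha.trans hb
  have hba : 0 < b - a := sub_pos.2 hb
  obtain ⟨C, hC, hmain⟩ := pow_le_of_forall_radius (κ := δ * G.real (Set.Iic (c - δ)))
    (E₁ := 2 * ((b - a) * (b * (2 * (n + 2 : ℕ)) / a))) (E₂ := 16 * b * (n + 2 : ℕ))
    (c₁ := 1 / 200) (by positivity) (by positivity) (by positivity) (by norm_num) n
  refine ⟨C, hC, fun B v => ?_⟩
  set m := ∫ t, (heavyCount c B v t : ℝ) ∂envMeasure (n + 2) G with hmdef
  have hm0 : 0 ≤ m := integral_nonneg fun t => Nat.cast_nonneg _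
  rcases hm0.eq_or_lt with hm | hm
  · rw [← hm, zero_pow (by omega)]; positivity
  have hmM : m ≤ B.card := by
    have h := integral_mono (μ := envMeasure (n + 2) G) (integrable_heavyCount _ c B v)
      (integrable_const (B.card : ℝ)) fun t => Nat.cast_le.2 (heavyCount_le c B v t)
    simpa using h
  have hMpos : (0 : ℝ) < B.card := hm.trans_le hmM
  have hM1 : (1 : ℝ) ≤ B.card := by exact_mod_cast (Nat.cast_pos.1 hMpos : 0 < B.card)
  obtain ⟨y, hy, hlevel⟩ := exists_level (μ := envMeasure (n + 2) G)
    (measurableSet_le_heavyCount c B v) (integrable_heavyCount _ c B v)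
    (fun t => (by exact_mod_cast heavyCount_le c B v t : (heavyCount c B v t : ℝ) ≤ B.card)) hm
  rw [← hmdef] at hy hlevel
  have hy0 : 0 < y := lt_of_lt_of_le (by positivity) hy
  have hsqrt : 1 ≤ Real.sqrt B.card := Real.one_le_sqrt.2 hM1
  have hsqrt0 : 0 < Real.sqrt B.card := by linarith
  set s : ℝ := 1 / (2 * Real.sqrt B.card) with hs
  have hs0 : 0 < s := by positivity
  have hs1 : s ≤ 1 / 2 := by
    rw [hs, div_le_div_iff₀ (by positivity) two_pos]; linarith
  have hsM : s ^ 2 * B.card = 1 / 4 := by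
    rw [hs, div_pow, mul_pow, Real.sq_sqrt hMpos.le]; field_simp; norm_num
  let s' : unitInterval := ⟨s, hs0.le, by linarith⟩
  let θ : Edge (n + 2) → unitInterval := fun e => if e ∈ B then s' else 0
  have hBs : ∀ e ∈ B, θ e = s' := fun e he => if_pos he
  have hB0 : ∀ e ∉ B, θ e = 0 := fun e he => if_neg he
  set F := {t | y ≤ heavyCount c B v t} with hF
  have hFm : MeasurableSet F := measurableSet_le_heavyCount c B v y
  set π := (jointMeasure G θ).real (high ⁻¹' F) with hπ
  have hcomp : (envMeasure (n + 2) G).real F ^ 3 ≤ π ^ 2 * Real.exp 2 := by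
    have h := ENNReal.toReal_mono (by finiteness)
      (envMeasure_pow_three_le (G := G) (θ := θ) (s := s') hs1 hBs hB0 hsM.le hFm)
    rwa [ENNReal.toReal_mul, ENNReal.toReal_pow, ENNReal.toReal_pow,
      ENNReal.toReal_ofReal (Real.exp_pos 2).le] at h
  have hexp : Real.exp 2 ≤ 8 := by
    have h1 := Real.exp_one_lt_d9
    have h2 : Real.exp 2 = Real.exp 1 ^ 2 := by rw [← Real.exp_nat_mul]; norm_num
    rw [h2]
    calc Real.exp 1 ^ 2 ≤ 2.7182818286 ^ 2 := by gcongr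
      _ ≤ 8 := by norm_num
  have hπ0 : 0 ≤ π := measureReal_nonneg
  have hπy : 1 / 200 * m ^ 2 ≤ π * y ^ 2 := by
    refine le_of_sq_le_sq ?_ (by positivity)
    have h1 : m ^ 4 ≤ 2000 * y ^ 4 * (π ^ 2 * 8) := by
      refine hlevel.trans ?_
      gcongr
      exact hcomp.trans (by gcongr)
    have h2 : 0 ≤ y ^ 4 * π ^ 2 := by positivity
    calc (1 / 200 * m ^ 2) ^ 2 = m ^ 4 / 40000 := by ring
      _ ≤ (π * y ^ 2) ^ 2 := by rw [div_le_iff₀ (by norm_num)]; nlinarith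
  refine hmain m B.card y π s hm hmM hy hπy hs0 hsM fun r => ?_
  refine (mul_prob_heavyCount_le ha hb hab (s := s') hBs hB0 hδ.le v hy0.le r).trans (le_of_eq ?_)
  change 2 * (s * (b - a) * _) + _ * (2 * (_ * π)) = _
  field_simp
  ring

end Count

/-! ### Obstructed edges are rare -/

section Obstructed

variable {G : Measure ℝ} [IsProbabilityMeasure G]

lemma envMeasure_forall_le (T : Finset (Edge d)) (c : ℝ) :
    envMeasure d G {t | ∀ f ∈ T, t f ≤ c} = G (Set.Iic c) ^ T.card := by
  have : {t : Edge d → ℝ | ∀ f ∈ T, t f ≤ c} = Set.pi (T : Set (Edge d)) fun _ => Set.Iic c := by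
    ext t; simp [Set.mem_pi]
  rw [this, envMeasure, Measure.infinitePi_pi _ fun _ _ => measurableSet_Iic, Finset.prod_const]

/-- A union bound over the starting point, the walk and the set of its cheap edges. -/
lemma envMeasure_obstructed_le {c : ℝ} {z : ℝ≥0∞} (hz1 : z ≤ 1) (hz : G (Set.Iic c) ≤ z ^ 2)
    (K : ℕ) (e : Edge d) :
    envMeasure d G {t | Obstructed c K t e} ≤
      ((2 * K + 1) ^ d : ℕ) * (((2 * d) ^ K : ℕ) * ((2 ^ K : ℕ) * z ^ K)) := by
  classical
  have hsub : {t | Obstructed c K t e} ⊆ ⋃ u ∈ box (base e) K,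
      ⋃ S ∈ (edgeFamily K u).filter fun S => S.card = K,
      ⋃ T ∈ S.powerset.filter fun T => K < 2 * T.card, {t : Edge d → ℝ | ∀ f ∈ T, t f ≤ c} := by
    rintro t ⟨u, hu, S, hS, hcard, hK⟩
    simp only [Set.mem_iUnion]
    exact ⟨u, hu, S, Finset.mem_filter.2 ⟨hS, hcard⟩, S.filter fun f => t f ≤ c,
      Finset.mem_filter.2 ⟨Finset.mem_powerset.2 (Finset.filter_subset _ _), hK⟩,
      fun f hf => (Finset.mem_filter.1 hf).2⟩
  have hT : ∀ S : Finset (Edge d), S.card = K →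
      envMeasure d G (⋃ T ∈ S.powerset.filter fun T => K < 2 * T.card,
        {t : Edge d → ℝ | ∀ f ∈ T, t f ≤ c}) ≤ (2 ^ K : ℕ) * z ^ K := by
    intro S hS
    refine (measure_biUnion_finset_le _ _).trans ?_
    refine (Finset.sum_le_card_nsmul _ _ (z ^ K) fun T hT => ?_).trans ?_
    · rw [envMeasure_forall_le]
      calc G (Set.Iic c) ^ T.card ≤ (z ^ 2) ^ T.card := by gcongr
        _ = z ^ (2 * T.card) := (pow_mul _ _ _).symm
        _ ≤ z ^ K := pow_le_pow_of_le_one (by simp) hz1 (Finset.mem_filter.1 hT).2.le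
    · rw [nsmul_eq_mul]
      gcongr
      exact (Finset.card_filter_le _ _).trans (by rw [Finset.card_powerset, hS])
  have hS : ∀ u : Fin d → ℤ,
      envMeasure d G (⋃ S ∈ (edgeFamily K u).filter fun S => S.card = K,
      ⋃ T ∈ S.powerset.filter fun T => K < 2 * T.card, {t : Edge d → ℝ | ∀ f ∈ T, t f ≤ c}) ≤
      ((2 * d) ^ K : ℕ) * ((2 ^ K : ℕ) * z ^ K) := by
    intro u
    refine (measure_biUnion_finset_le _ _).trans ?_
    refine (Finset.sum_le_card_nsmul _ _ _ fun S hS => hT S (Finset.mem_filter.1 hS).2).trans ?_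
    rw [nsmul_eq_mul]
    gcongr
    exact (Finset.card_filter_le _ _).trans (card_edgeFamily_le K u)
  refine (measure_mono hsub).trans ((measure_biUnion_finset_le _ _).trans ?_)
  refine (Finset.sum_le_card_nsmul _ _ _ fun u _ => hS u).trans ?_
  rw [nsmul_eq_mul, card_box]

lemma two_mul_add_one_le_exp (K : ℕ) : (2 * K + 1 : ℝ) ≤ 2 * Real.exp K := by
  have := Real.add_one_le_exp (K : ℝ)
  have := Real.exp_pos (K : ℝ)
  linarith

/-- If cheap edges are sufficiently rare, the probability of an obstruction at scale `K` is at most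
`exp (-d K) / 2`. -/
lemma envMeasure_real_obstructed_le {c ζ : ℝ} (hζ : 0 ≤ ζ)
    (hζd : 4 * d * ζ ≤ Real.exp (-(2 * d)) * (1 / 2) ^ (d + 1)) (hζ1 : ζ ≤ 1)
    (hG : G.real (Set.Iic c) ≤ ζ ^ 2) {K : ℕ} (hK : 1 ≤ K) (e : Edge d) :
    (envMeasure d G).real {t | Obstructed c K t e} ≤ Real.exp (-(d * K)) / 2 := by
  have h := envMeasure_obstructed_le (G := G) (z := ENNReal.ofReal ζ) (c := c)
    (by simpa using hζ1) (by
      rw [← ENNReal.ofReal_pow hζ, ← ofReal_measureReal]; exact ENNReal.ofReal_le_ofReal hG) K e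
  have h' := ENNReal.toReal_mono (by finiteness) h
  simp only [ENNReal.toReal_mul, ENNReal.toReal_pow, ENNReal.toReal_natCast,
    ENNReal.toReal_ofReal hζ] at h'
  push_cast at h'
  refine h'.trans ?_
  have hhalf : ((1 : ℝ) / 2) ^ (d + 1) ≤ 1 := pow_le_one₀ (by norm_num) (by norm_num)
  calc (2 * K + 1 : ℝ) ^ d * ((2 * d) ^ K * (2 ^ K * ζ ^ K))
      = (2 * K + 1 : ℝ) ^ d * (4 * d * ζ) ^ K := by rw [← mul_pow, ← mul_pow]; ring
    _ ≤ (2 * Real.exp K) ^ d * (Real.exp (-(2 * d)) * (1 / 2) ^ (d + 1)) ^ K := by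
        gcongr
        exact two_mul_add_one_le_exp K
    _ ≤ (2 * Real.exp K) ^ d * (Real.exp (-(2 * d)) ^ K * (1 / 2) ^ (d + 1)) := by
        rw [mul_pow (Real.exp (-(2 * (d : ℝ))))]
        gcongr
        exact pow_le_of_le_one (by positivity) hhalf (by omega)
    _ = Real.exp (-(d * K)) / 2 := by
        rw [mul_pow, ← Real.exp_nat_mul, ← Real.exp_nat_mul]
        have h1 : (2 : ℝ) ^ d * (1 / 2) ^ (d + 1) = 1 / 2 := by
          rw [pow_succ, ← mul_assoc, ← mul_pow]; norm_num
        calc _ = (2 : ℝ) ^ d * (1 / 2) ^ (d + 1) *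
              (Real.exp (d * K) * Real.exp (K * -(2 * d))) := by ring
          _ = 1 / 2 * Real.exp (-(d * K)) := by rw [h1, ← Real.exp_add]; congr 2; ring
          _ = _ := by ring

end Obstructed

/-! ### Many likely edges force many heavy edges -/

lemma latticeNorm_le_l1 (v : Fin d → ℤ) : latticeNorm v ≤ l1 0 v := by
  have hl : (l1 0 v : ℝ) = ∑ i, |(v i : ℝ)| := by
    simp [l1, Nat.cast_natAbs]
  rw [hl, latticeNorm, Real.sqrt_le_left (Finset.sum_nonneg fun i _ => abs_nonneg _)]
  simp_rw [← sq_abs (v _ : ℝ)]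
  exact Finset.sum_sq_le_sq_sum_of_nonneg fun i _ => abs_nonneg _

lemma l1_le_mul_latticeNorm (v : Fin d → ℤ) : (l1 0 v : ℝ) ≤ d * latticeNorm v := by
  have hl : (l1 0 v : ℝ) = ∑ i, |(v i : ℝ)| := by
    simp [l1, Nat.cast_natAbs]
  rw [hl]
  calc ∑ i, |(v i : ℝ)| ≤ ∑ _i : Fin d, latticeNorm v := by
        refine Finset.sum_le_sum fun i _ => Real.abs_le_sqrt ?_
        exact Finset.single_le_sum (f := fun i => (v i : ℝ) ^ 2) (fun _ _ => sq_nonneg _)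
          (Finset.mem_univ i)
    _ = d * latticeNorm v := by simp

section Likely

variable {G : Measure ℝ} [IsProbabilityMeasure G] [NullSingletonClass G] {a b : ℝ}

/-- If each edge of `A` lies on the geodesic with probability at least `ε` and obstructions are
rare, the expected number of heavy edges near `A` on the geodesic is at least of order `ε |A|`. -/
lemma le_integral_heavyCount (ha : 0 < a) (hb : 0 < b) (hab : ∀ᵐ x ∂G, x ∈ Set.Icc a b)
    {c ε : ℝ} {K : ℕ} (hK : 1 ≤ K) {v : Fin d → ℤ} (hKv : K ≤ l1 0 v) {A : Finset (Edge d)}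
    (hA : ∀ e ∈ A, ε ≤ (envMeasure d G).real {t | e ∈ geodesicEdges t 0 v})
    (hobs : ∀ e ∈ A, (envMeasure d G).real {t | Obstructed c K t e} ≤ ε / 2) :
    a * ε * A.card ≤
      24 * b * d * ∫ t, (heavyCount c (thicken K A) v t : ℝ) ∂envMeasure d G := by
  classical
  set μ := envMeasure d G with hμ
  let U : Edge d → Set (Edge d → ℝ) := fun e => toMeasurable μ {t | Obstructed c K t e}
  have hU : ∀ e, MeasurableSet (U e) := fun e => measurableSet_toMeasurable _ _
  have hi1 : ∀ e, Integrable
      ({t : Edge d → ℝ | e ∈ geodesicEdges t 0 v}.indicator (1 : (Edge d → ℝ) → ℝ)) μ := fun e =>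
    (integrable_const (1 : ℝ)).indicator (measurableSet_mem_geodesicEdges 0 v e)
  have hi2 : ∀ e, Integrable ((U e).indicator (1 : (Edge d → ℝ) → ℝ)) μ := fun e =>
    (integrable_const (1 : ℝ)).indicator (hU e)
  have hpt : ∀ᵐ t ∂μ, a * ∑ e ∈ A, ({t | e ∈ geodesicEdges t 0 v}.indicator
      (1 : (Edge d → ℝ) → ℝ) t - (U e).indicator (1 : (Edge d → ℝ) → ℝ) t) ≤
      12 * b * d * (heavyCount c (thicken K A) v t : ℝ) := by
    filter_upwards [ae_regular_envMeasure G ha hab] with t ht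
    obtain ⟨p, hp⟩ := exists_geodesic ha ht.1 0 v
    have hgeo := geodesicEdges_eq (ht.2 0 v) hp
    have hKp : K ≤ (pathEdges p).card := by
      rw [pathEdges_eq, card_walkEdges p.2]
      exact hKv.trans (l1_le_length p.1)
    have h := card_not_obstructed_le ha hb ht.1 hp hK hKp (c := c) A
    have hY : heavyCount c (thicken K A) v t =
        ((thicken K A).filter fun f => f ∈ pathEdges p ∧ c < t f).card := by
      rw [heavyCount, hgeo]; simp only [Finset.mem_coe]
    rw [hY]
    refine le_trans (mul_le_mul_of_nonneg_left ?_ ha.le) h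
    rw [Finset.card_filter]
    push_cast
    refine Finset.sum_le_sum fun e _ => ?_
    simp only [Set.indicator_apply, Set.mem_ofPred_eq, hgeo, Finset.mem_coe, Pi.one_apply]
    by_cases hobs : Obstructed c K t e
    · rw [if_pos (subset_toMeasurable μ _ hobs : t ∈ U e)]
      split_ifs <;> norm_num
    · simp only [hobs, not_false_eq_true, and_true]
      split_ifs <;> norm_num
  have hint := integral_mono_ae ((integrable_finsetSum A fun e _ =>
    (hi1 e).sub (hi2 e)).const_mul a)
    ((integrable_heavyCount μ c (thicken K A) v).const_mul (12 * b * d)) hpt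
  rw [integral_const_mul, integral_const_mul, integral_finsetSum _ fun e _ =>
    (hi1 e).sub (hi2 e)] at hint
  simp only [Pi.sub_apply] at hint
  have hsum : A.card * (ε / 2) ≤ ∑ e ∈ A, ∫ t, ({t | e ∈ geodesicEdges t 0 v}.indicator
      (1 : (Edge d → ℝ) → ℝ) t - (U e).indicator (1 : (Edge d → ℝ) → ℝ) t) ∂μ := by
    rw [← nsmul_eq_mul]
    refine Finset.card_nsmul_le_sum _ _ _ fun e he => ?_
    rw [integral_sub (hi1 e) (hi2 e),
      integral_indicator_one (measurableSet_mem_geodesicEdges 0 v e), integral_indicator_one (hU e)]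
    have h1 : μ.real (U e) ≤ ε / 2 := by
      rw [Measure.real, measure_toMeasurable]; exact hobs e he
    linarith [hA e he]
  have := mul_le_mul_of_nonneg_left hsum ha.le
  linarith

/-- All edges that may lie on the geodesic from `0` to `v` are at distance `O(‖v‖)` from `0`. -/
lemma mem_boxEdges_of_measure_pos (ha : 0 < a) (hb : 0 < b) (hab : ∀ᵐ x ∂G, x ∈ Set.Icc a b)
    (v : Fin d → ℤ) {e : Edge d} (he : 0 < (envMeasure d G).real {t | e ∈ geodesicEdges t 0 v}) :
    e ∈ boxEdges 0 ⌈b / a * (d * latticeNorm v)⌉₊ := by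
  by_contra hne
  have h0 : envMeasure d G {t | e ∈ geodesicEdges t 0 v} = 0 := by
    rw [← nonpos_iff_eq_zero, ← measure_empty (μ := envMeasure d G)]
    refine measure_mono_ae ?_
    filter_upwards [ae_regular_envMeasure G ha hab] with t ht hmem
    obtain ⟨p, hp, hep⟩ := hmem
    refine hne (pathEdges_subset_boxEdges p ?_ hep)
    have h1 := card_geodesic_le ha hb ht.1 hp
    rw [← Nat.cast_le (α := ℝ)]
    refine le_trans ?_ (Nat.le_ceil _)
    have h2 := mul_le_mul_of_nonneg_left (l1_le_mul_latticeNorm v) hb.le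
    rw [div_mul_eq_mul_div, le_div_iff₀ ha]
    linarith
  rw [Measure.real, h0] at he
  simp at he

/-- The bound on the number of likely edges, with all powers cleared. -/
lemma exists_card_pow_mul_pow_le (hd : 2 ≤ d) (ha : 0 < a) (hb : a < b)
    (hab : ∀ᵐ x ∂G, x ∈ Set.Icc a b)
    {c δ ζ : ℝ} (hδ : 0 < δ) (hG : 0 < G.real (Set.Iic (c - δ))) (hζ : 0 ≤ ζ) (hζ1 : ζ ≤ 1)
    (hζd : 4 * d * ζ ≤ Real.exp (-(2 * d)) * (1 / 2) ^ (d + 1))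
    (hGζ : G.real (Set.Iic c) ≤ ζ ^ 2) :
    ∃ C : ℝ, 0 < C ∧ ∀ v : Fin d → ℤ, 2 ≤ latticeNorm v → ∀ ε : ℝ, 0 < ε →
      ∀ A : Finset (Edge d),
        (∀ e ∈ A, ε ≤ (envMeasure d G).real {t | e ∈ geodesicEdges t 0 v}) →
        (A.card : ℝ) ^ (d - 1) * ε ^ (2 * d) ≤ C * Real.log (latticeNorm v) ^ (d * (d + 1)) := by
  obtain ⟨n, rfl⟩ := Nat.exists_eq_add_of_le' hd
  have hb0 : 0 < b := ha.trans hb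
  obtain ⟨C, hC, hmain⟩ := integral_heavyCount_pow_le (G := G) hd ha hb hab hδ hG
  set D : ℝ := ((n + 2 : ℕ) : ℝ) with hD
  have hD0 : 0 < D := by rw [hD]; positivity
  have hD' : D = n + 2 := by rw [hD]; push_cast; rfl
  have hlog2 : 1 / 2 ≤ Real.log 2 := by linarith [Real.log_two_gt_d9]
  -- `C₁` takes care of `ε ≥ ‖v‖ ^ (-d)`, and `C₂` of smaller `ε`.
  set C₁ : ℝ := C * (7 ^ (n + 2) * (2 * D) * 3 ^ (n + 2)) ^ (n + 2 + 1) *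
    (24 * b * D / a) ^ (2 * (n + 2)) with hC₁
  set C₂ : ℝ := ((2 * (b / a * D) + 3) ^ (n + 2) * (2 * D)) ^ (n + 1) *
    2 ^ ((n + 2) * (n + 2 + 1)) with hC₂
  have hC₁0 : 0 < C₁ := by positivity
  have hC₂0 : 0 < C₂ := by positivity
  refine ⟨C₁ + C₂, by positivity, fun v hv ε hε A hA => ?_⟩
  set N := latticeNorm v with hN
  have hN0 : 0 < N := by linarith
  set L := Real.log N with hL
  have hL2 : 1 / 2 ≤ L := hlog2.trans (Real.log_le_log two_pos hv)
  have hL0 : 0 < L := by linarith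
  change (A.card : ℝ) ^ (n + 1) * ε ^ (2 * (n + 2)) ≤ _
  rcases lt_or_ge ε ((N ^ (n + 2))⁻¹) with hsmall | hlarge
  · -- Only the trivial bound `|A| = O(‖v‖ ^ d)` is needed here.
    have hcard : (A.card : ℝ) ≤ ((2 * (b / a * D) + 3) ^ (n + 2) * (2 * D)) * N ^ (n + 2) := by
      have hsub : A ⊆ boxEdges 0 ⌈b / a * (D * N)⌉₊ := fun e he =>
        mem_boxEdges_of_measure_pos ha hb0 hab v (hε.trans_le (hA e he))
      have h1 : (A.card : ℝ) ≤ (2 * (⌈b / a * (D * N)⌉₊ : ℝ) + 1) ^ (n + 2) * (2 * D) := by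
        refine (Nat.cast_le.2 ((Finset.card_le_card hsub).trans (card_boxEdges_le _ _))).trans
          (le_of_eq ?_)
        rw [hD']; push_cast; ring
      have h2 : (⌈b / a * (D * N)⌉₊ : ℝ) ≤ b / a * (D * N) + 1 :=
        (Nat.ceil_lt_add_one (by positivity)).le
      refine h1.trans ?_
      have h3 : (2 * (⌈b / a * (D * N)⌉₊ : ℝ) + 1) ≤ (2 * (b / a * D) + 3) * N := by
        nlinarith
      calc (2 * (⌈b / a * (D * N)⌉₊ : ℝ) + 1) ^ (n + 2) * (2 * D)
          ≤ ((2 * (b / a * D) + 3) * N) ^ (n + 2) * (2 * D) := by gcongr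
        _ = _ := by rw [mul_pow]; ring
    have hεN : N ^ (n + 2) * ε ≤ 1 := by
      have h := mul_le_mul_of_nonneg_left hsmall.le (pow_pos hN0 (n + 2)).le
      rwa [mul_inv_cancel₀ (pow_pos hN0 _).ne'] at h
    have hN1 : 1 ≤ N ^ (n + 2) := one_le_pow₀ (by linarith)
    have hε1 : ε ≤ 1 := by nlinarith
    have hLpow : 1 ≤ 2 ^ ((n + 2) * (n + 2 + 1)) * L ^ ((n + 2) * (n + 2 + 1)) := by
      rw [← mul_pow]; exact one_le_pow₀ (by linarith)
    calc (A.card : ℝ) ^ (n + 1) * ε ^ (2 * (n + 2))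
        ≤ (((2 * (b / a * D) + 3) ^ (n + 2) * (2 * D)) * N ^ (n + 2)) ^ (n + 1) *
          ε ^ (n + 1) := by
          refine mul_le_mul (by gcongr) (pow_le_pow_of_le_one hε.le hε1 (by omega))
            (by positivity) (by positivity)
      _ = ((2 * (b / a * D) + 3) ^ (n + 2) * (2 * D)) ^ (n + 1) *
          (N ^ (n + 2) * ε) ^ (n + 1) := by rw [mul_pow, mul_pow, mul_pow]; ring
      _ ≤ ((2 * (b / a * D) + 3) ^ (n + 2) * (2 * D)) ^ (n + 1) * 1 := by
          gcongr
          exact pow_le_one₀ (by positivity) hεN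
      _ ≤ ((2 * (b / a * D) + 3) ^ (n + 2) * (2 * D)) ^ (n + 1) *
          (2 ^ ((n + 2) * (n + 2 + 1)) * L ^ ((n + 2) * (n + 2 + 1))) := by gcongr
      _ = C₂ * L ^ ((n + 2) * (n + 2 + 1)) := by rw [hC₂]; ring
      _ ≤ (C₁ + C₂) * L ^ ((n + 2) * (n + 2 + 1)) := by gcongr; linarith
  · rcases Nat.eq_zero_or_pos A.card with h0 | h0
    · rw [h0]; simp; positivity
    have hA0 : (0 : ℝ) < A.card := by exact_mod_cast h0
    set K := ⌈L⌉₊ with hK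
    have hK1 : 1 ≤ K := Nat.one_le_ceil_iff.2 hL0
    have hLK : L ≤ K := Nat.le_ceil L
    have hK3 : (K : ℝ) ≤ 3 * L := by
      have := (Nat.ceil_lt_add_one hL0.le).le
      linarith
    have hKv : K ≤ l1 0 v := by
      refine Nat.ceil_le.2 (le_trans ?_ (latticeNorm_le_l1 v))
      have := Real.log_le_sub_one_of_pos hN0
      linarith
    have hobs : ∀ e ∈ A, (envMeasure (n + 2) G).real {t | Obstructed c K t e} ≤ ε / 2 := by
      intro e _
      refine (envMeasure_real_obstructed_le hζ hζd hζ1 hGζ hK1 e).trans ?_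
      have h1 : Real.exp (-(((n + 2 : ℕ) : ℝ) * K)) ≤ (N ^ (n + 2))⁻¹ := by
        rw [Real.exp_neg, Real.exp_nat_mul]
        gcongr
        rw [← Real.exp_log hN0]
        exact Real.exp_le_exp.2 hLK
      linarith
    have hlow := le_integral_heavyCount ha hb0 hab hK1 hKv hA hobs
    have hup := hmain (thicken K A) v
    set m := ∫ t, (heavyCount c (thicken K A) v t : ℝ) ∂envMeasure (n + 2) G
    have hB : ((thicken K A).card : ℝ) ≤ A.card * (7 ^ (n + 2) * (2 * D) * 3 ^ (n + 2)) *
        L ^ (n + 2) := by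
      have h1 : ((thicken K A).card : ℝ) ≤ A.card * ((2 * K + 1) ^ (n + 2) * (2 * D)) := by
        refine (Nat.cast_le.2 (card_thicken_le K A)).trans (le_of_eq ?_)
        rw [hD']; push_cast; ring
      refine h1.trans ?_
      have h2 : (2 * K + 1 : ℝ) ≤ 7 * 3 * L := by linarith
      calc (A.card : ℝ) * ((2 * K + 1) ^ (n + 2) * (2 * D))
          ≤ A.card * ((7 * 3 * L) ^ (n + 2) * (2 * D)) := by gcongr
        _ = _ := by rw [mul_pow, mul_pow]; ring
    have hm : ε * A.card ≤ 24 * b * D / a * m := by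
      rw [div_mul_eq_mul_div, le_div_iff₀ ha]; linarith
    have hfin : (A.card : ℝ) ^ (n + 1) * ε ^ (2 * (n + 2)) * (A.card : ℝ) ^ (n + 3) ≤
        C₁ * L ^ ((n + 2) * (n + 2 + 1)) * (A.card : ℝ) ^ (n + 3) := by
      calc (A.card : ℝ) ^ (n + 1) * ε ^ (2 * (n + 2)) * (A.card : ℝ) ^ (n + 3)
          = (ε * A.card) ^ (2 * (n + 2)) := by rw [mul_pow]; ring
        _ ≤ (24 * b * D / a * m) ^ (2 * (n + 2)) := by gcongr
        _ = (24 * b * D / a) ^ (2 * (n + 2)) * m ^ (2 * (n + 2)) := mul_pow _ _ _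
        _ ≤ (24 * b * D / a) ^ (2 * (n + 2)) * (C * (A.card *
            (7 ^ (n + 2) * (2 * D) * 3 ^ (n + 2)) * L ^ (n + 2)) ^ (n + 2 + 1)) := by
          gcongr
          exact hup.trans (by gcongr)
        _ = _ := by
          rw [hC₁, mul_pow _ (L ^ (n + 2)), mul_pow (A.card : ℝ), ← pow_mul]; ring
    refine (le_of_mul_le_mul_right hfin (by positivity)).trans ?_
    gcongr
    linarith

end Likely

/-! ### Properties of the weight distribution -/

section Weights

variable {G : Measure ℝ}

lemma HasUniformlyPositiveDensity.nullSingletonClass (hG : HasUniformlyPositiveDensity G) :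
    NullSingletonClass G := by
  obtain ⟨a, b, α, -, -, -, -, ρ, -, hρ, -⟩ := hG
  refine ⟨fun x => ?_⟩
  rw [hρ]
  exact withDensity_absolutelyContinuous _ _ (measure_singleton x)

lemma measure_Iic_pos {a b α : ℝ} (hab : a < b) (hα : 0 < α) {ρ : ℝ → ℝ≥0∞}
    (hG : G = volume.withDensity ρ)
    (hρ : ∀ᵐ x : ℝ, x ∈ Set.Icc a b → ENNReal.ofReal α ≤ ρ x) {x : ℝ} (hx : a < x) :
    0 < G (Set.Iic x) := by
  refine lt_of_lt_of_le ?_ (measure_mono (Set.Icc_subset_Iic_self.trans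
    (Set.Iic_subset_Iic.2 (min_le_right b x))) : G (Set.Icc a (min b x)) ≤ _)
  rw [hG, withDensity_apply _ measurableSet_Icc]
  have h1 : ∫⁻ _ in Set.Icc a (min b x), ENNReal.ofReal α ≤ ∫⁻ y in Set.Icc a (min b x), ρ y := by
    refine lintegral_mono_ae ((ae_restrict_iff' measurableSet_Icc).2 ?_)
    filter_upwards [hρ] with y hy hyx
    exact hy ⟨hyx.1, hyx.2.trans (min_le_left _ _)⟩
  refine lt_of_lt_of_le ?_ h1
  rw [setLIntegral_const, Real.volume_Icc]
  have : 0 < min b x - a := sub_pos.2 (lt_min hab hx)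
  exact ENNReal.mul_pos (ENNReal.ofReal_pos.2 hα).ne' (ENNReal.ofReal_pos.2 this).ne'

/-- An atomless law without mass below `a` gives little mass to a right neighbourhood of `a`. -/
lemma exists_measureReal_Iic_le [IsProbabilityMeasure G] [NullSingletonClass G] {a b : ℝ}
    (hab : ∀ᵐ x ∂G, x ∈ Set.Icc a b) {η : ℝ} (hη : 0 < η) :
    ∃ δ, 0 < δ ∧ G.real (Set.Iic (a + 2 * δ)) ≤ η := by
  have h0 : cdf G a = 0 := by
    rw [cdf_eq_real, ← measureReal_congr Iio_ae_eq_Iic, Measure.real,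
      show G (Set.Iio a) = 0 from ?_, ENNReal.toReal_zero]
    refine measure_mono_null (fun x hx => ?_) (ae_iff.1 hab)
    exact fun h => not_le.2 hx h.1
  have hc := (cdf G).right_continuous a
  have hev : ∀ᶠ x in nhdsWithin a (Set.Ici a), cdf G x < η :=
    hc.eventually (gt_mem_nhds (by rw [h0]; exact hη))
  obtain ⟨u, hu, hsub⟩ := (mem_nhdsGE_iff_exists_Ico_subset).1 hev
  have hu' : a < u := hu
  refine ⟨(u - a) / 4, by linarith, ?_⟩
  rw [← cdf_eq_real]
  exact (hsub ⟨by linarith, by linarith⟩ : cdf G _ < η).le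

end Weights

end FPP

theorem theorem1p2 (d : ℕ) (hd : 2 ≤ d) (G : Measure ℝ) [IsProbabilityMeasure G]
    (hG : FPP.HasUniformlyPositiveDensity G) :
    ∃ C : ℝ, 0 < C ∧
      ∀ (Ω : Type*) [MeasurableSpace Ω] (P : Measure Ω) [IsProbabilityMeasure P]
        (t : FPP.Edge d → Ω → ℝ),
        (∀ e, HasLaw (t e) G P) → iIndepFun t P →
        ∀ v : Fin d → ℤ, 2 ≤ FPP.latticeNorm v →
          (∀ᵐ ω ∂P, ∃! p : FPP.LatticePath 0 v, FPP.IsGeodesic (fun e => t e ω) p) ∧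
          ∀ ε : ℝ, 0 < ε →
            {e : FPP.Edge d |
              ε ≤ P.real {ω | e ∈ FPP.geodesicEdges (fun e' => t e' ω) 0 v}}.Finite ∧
            ({e : FPP.Edge d |
              ε ≤ P.real {ω | e ∈ FPP.geodesicEdges (fun e' => t e' ω) 0 v}}.ncard : ℝ) ≤
              C * ε ^ (-(2 * (d : ℝ) / ((d : ℝ) - 1))) *
                Real.log (FPP.latticeNorm v) ^ ((d : ℝ) * ((d : ℝ) + 1) / ((d : ℝ) - 1)) := by
  have hnull := hG.nullSingletonClass
  obtain ⟨a, b, α, ha, hb, hα, hsupp, ρ, -, hGρ, hρ⟩ := hG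
  have hb0 : 0 < b := ha.trans hb
  have hab : ∀ᵐ x ∂G, x ∈ Set.Icc a b := by rw [ae_iff]; exact hsupp
  have hd0 : (0 : ℝ) < d := by exact_mod_cast (by omega : 0 < d)
  have hd1 : (0 : ℝ) < (d : ℝ) - 1 := by
    have : (2 : ℝ) ≤ d := by exact_mod_cast hd
    linarith
  -- Edges of weight at most `a + 2 δ` have probability at most `ζ ^ 2` and do not percolate.
  set ζ : ℝ := min 1 (Real.exp (-(2 * d)) * (1 / 2) ^ (d + 1) / (4 * d)) with hζ
  have hζ0 : 0 < ζ := lt_min one_pos (by positivity)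
  have hζd : 4 * d * ζ ≤ Real.exp (-(2 * d)) * (1 / 2) ^ (d + 1) := by
    have := min_le_right 1 (Real.exp (-(2 * (d : ℝ))) * (1 / 2) ^ (d + 1) / (4 * d))
    rw [← hζ, le_div_iff₀ (by positivity)] at this
    linarith
  obtain ⟨δ, hδ, hGδ⟩ := FPP.exists_measureReal_Iic_le hab (sq_pos_of_pos hζ0)
  have hpos : 0 < G.real (Set.Iic (a + 2 * δ - δ)) :=
    ENNReal.toReal_pos (FPP.measure_Iic_pos hb hα hGρ hρ (by linarith)).ne' (measure_ne_top _ _)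
  obtain ⟨C, hC, hbound⟩ :=
    FPP.exists_card_pow_mul_pow_le hd ha hb hab hδ hpos hζ0.le (min_le_left _ _) hζd hGδ
  refine ⟨C ^ (1 / ((d : ℝ) - 1)), by positivity, ?_⟩
  intro Ω _ P _ t hlaw hindep v hv
  have haem : AEMeasurable (fun ω e => t e ω) P :=
    aemeasurable_pi_iff.2 fun e => (hlaw e).aemeasurable
  have hmap : P.map (fun ω e => t e ω) = FPP.envMeasure d G := by
    rw [hindep.map_fun_eq_infinitePi_map₀ haem]
    simp only [(hlaw _).map_eq]
    rfl
  have hreg := FPP.ae_regular_envMeasure (d := d) G ha hab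
  rw [← hmap] at hreg
  refine ⟨?_, fun ε hε => ?_⟩
  · filter_upwards [ae_of_ae_map haem hreg] with ω hω
    exact hω.2 0 v
  have hprob : ∀ e, P.real {ω | e ∈ FPP.geodesicEdges (fun e' => t e' ω) 0 v} =
      (FPP.envMeasure d G).real {t | e ∈ FPP.geodesicEdges t 0 v} := fun e => by
    rw [← hmap, Measure.real, Measure.real,
      Measure.map_apply_of_aemeasurable haem (FPP.measurableSet_mem_geodesicEdges 0 v e)]
    rfl
  simp only [hprob]
  have hfin : {e : FPP.Edge d |
      ε ≤ (FPP.envMeasure d G).real {t | e ∈ FPP.geodesicEdges t 0 v}}.Finite :=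
    (FPP.boxEdges 0 ⌈b / a * (d * FPP.latticeNorm v)⌉₊).finite_toSet.subset fun e he =>
      FPP.mem_boxEdges_of_measure_pos ha hb0 hab v (hε.trans_le he)
  refine ⟨hfin, ?_⟩
  rw [Set.ncard_eq_toFinset_card _ hfin]
  set N : ℝ := (hfin.toFinset.card : ℝ) with hN
  have hN0 : 0 ≤ N := Nat.cast_nonneg _
  have hL0 : 0 ≤ Real.log (FPP.latticeNorm v) := Real.log_nonneg (by linarith)
  have hkey := hbound v hv ε hε hfin.toFinset fun e he => hfin.mem_toFinset.1 he
  have hcast : ((d - 1 : ℕ) : ℝ) = (d : ℝ) - 1 := by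
    rw [Nat.cast_sub (by omega), Nat.cast_one]
  have hkey' : N ^ ((d : ℝ) - 1) ≤
      C * ε ^ (-(2 * (d : ℝ))) * Real.log (FPP.latticeNorm v) ^ ((d : ℝ) * ((d : ℝ) + 1)) := by
    have e1 : ε ^ (-(2 * (d : ℝ))) = (ε ^ (2 * d))⁻¹ := by
      rw [Real.rpow_neg hε.le, ← Real.rpow_natCast]; push_cast; rfl
    have e2 : Real.log (FPP.latticeNorm v) ^ ((d : ℝ) * ((d : ℝ) + 1)) =
        Real.log (FPP.latticeNorm v) ^ (d * (d + 1)) := by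
      rw [← Real.rpow_natCast]; push_cast; rfl
    rw [e1, e2, ← hcast, Real.rpow_natCast, mul_right_comm, ← div_eq_mul_inv,
      le_div_iff₀ (by positivity)]
    exact hkey
  have hroot := Real.rpow_le_rpow (Real.rpow_nonneg hN0 _) hkey'
    (by positivity : 0 ≤ 1 / ((d : ℝ) - 1))
  rw [← Real.rpow_mul hN0, mul_one_div_cancel hd1.ne', Real.rpow_one,
    Real.mul_rpow (by positivity) (by positivity), Real.mul_rpow (by positivity) (by positivity),
    ← Real.rpow_mul hε.le, ← Real.rpow_mul hL0] at hroot
  refine hroot.trans (le_of_eq ?_)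
  congr 2
  · congr 1; ring
  · congr 1; ring
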